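/- Let $l>0$, let $V\in L^2[0,l]$ be real-valued, and let $\alpha\in\mathbb R$, $\beta\in\mathbb R\setminus\{0\}$. Consider the square lattice in the plane with nodes $(ml,nl)$, $m,n\in\mathbb Z$, and edges $E_{m,n,r}$ from $(ml,nl)$ to $((m+1)l,nl)$ and $E_{m,n,u}$ from $(ml,nl)$ to $(ml,(n+1)l)$, each identified with $[0,l]$ (with $0$ at $(ml,nl)$). Let $b\in C(\mathbb R^2)$ be real-valued and $l$-periodic in each variable, and put $$\xi=\frac1{2\pi l^2}\int_{[0,l]^2}b\,dx,\qquad \theta=\xi l^2 .$$ Let $A_1,A_2$ be continuous real-valued functions on $\mathbb R^2$, $l$-periodic in each variable, with $\partial_1A_2-\partial_2A_1=b-2\pi\xi$ in the sense of distributions, such that $t\mapsto A_1(t,0)$ and $t\mapsto A_2(0,t)$ belong to $H^1[0,l]$ (as is the case for $C^1$ functions $A_1,A_2$). Let $A(x_1,x_2)=\big(-\pi\xi x_2+A_1(x_1,x_2),\ \pi\xi x_1+A_2(x_1,x_2)\big)$ be the vector potential of $b$, and let $A_{m,n,r}(t)$ be the first component of $A(ml+t,nl)$ and $A_{m,n,u}(t)$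 the second component of $A(ml,nl+t)$, $t\in[0,l]$. In the Hilbert space $\mathcal H=\bigoplus_{(m,n)\in\mathbb Z^2}\big(L^2[0,l]\oplus L^2[0,l]\big)$, with elements $f=(f_{m,n,r},f_{m,n,u})$, let $L$ be the operator acting on each edge as $$f_{m,n,j}\mapsto\Big(-i\frac{d}{dt}-A_{m,n,j}\Big)^2f_{m,n,j}+Vf_{m,n,j},\qquad j\in\{r,u\},$$ whose domain consists of all $f\in\mathcal H$ with $f_{m,n,j}\in H^2[0,l]$ for which the result lies in $\mathcal H$ and which satisfy, for all $m,n\in\mathbb Z$, $$f_{m,n,r}(0)=\tfrac1\beta f_{m,n,u}(0)=f_{m-1,n,r}(l)=\tfrac1\beta f_{m,n-1,u}(l)=:f_{m,n},$$ $$\Big(\frac d{dt}-iA_{m,n,r}\Big)f_{m,n,r}(0)+\beta\Big(\frac d{dt}-iA_{m,n,u}\Big)f_{m,n,u}(0)-\Big(\frac d{dt}-iA_{m-1,n,r}\Big)f_{m-1,n,r}(l)-\beta\Big(\frac d{dt}-iA_{m,n-1,u}\Big)f_{m,n-1,u}(l)=\alpha f_{m,n}.$$ Let $D$ be the operator $Df=-f''+Vf$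 in $L^2[0,l]$ with domain $\{f\in H^2[0,l]: f(0)=f(l)=0\}$. For $z\in\mathbb C$ let $u_1(\cdot;z),u_2(\cdot;z)\in H^2[0,l]$ be the solutions of $-u''+Vu=zu$ with $u_1(0;z)=0$, $u_1'(0;z)=1$, $u_2(0;z)=1$, $u_2'(0;z)=0$, and for $z\notin\operatorname{spec}D$ put $$s(z)=\begin{pmatrix}s_{11}(z)&s_{12}(z)\\ s_{21}(z)&s_{22}(z)\end{pmatrix}=\frac1{u_1(l;z)}\begin{pmatrix}-u_2(l;z)&1\\1&-u_1'(l;z)\end{pmatrix}.$$ Let $M(\theta,\beta)$ be the bounded operator on $\ell^2(\mathbb Z^2)$ given by $$\big(M(\theta,\beta)g\big)_{m,n}=e^{i\pi n\theta}g_{m+1,n}+e^{-i\pi n\theta}g_{m-1,n}+\beta^2\big(e^{-i\pi m\theta}g_{m,n+1}+e^{i\pi m\theta}g_{m,n-1}\big).$$ Then a number $z\in\mathbb R\setminus\operatorname{spec}D$ lies in the spectrum of $L$ if and only if $$0\in\operatorname{spec}\Big[(1+\beta^2)\big(s_{11}(z)+s_{22}(z)\big)-\alpha+s_{12}(z)\,M(\theta,\beta)\Big].$$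 -/

import Mathlib

open MeasureTheory Set

open scoped ContDiff

noncomputable section

namespace QuantumGraph

/-! ### Sobolev functions on the segment `[0, l]` -/

/-- Lebesgue measure on the segment `[0, l]`. -/
abbrev edgeMeasure (l : ℝ) : Measure ℝ := volume.restrict (Icc 0 l)

/-- The derivative of a function on the segment `[0, l]` (one-sided at the end points). -/
def edgeDeriv {E : Type*} [NormedAddCommGroup E] [NormedSpace ℝ E] (l : ℝ) (u : ℝ → E) : ℝ → E :=
  derivWithin u (Icc 0 l)

/-- `u` is (the continuous representative of) an element of `H¹[0, l]`: it is absolutely continuous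
on `[0, l]` with a derivative in `L²`, i.e. it is a primitive of an `L²` function. -/
def MemH1 {E : Type*} [NormedAddCommGroup E] [NormedSpace ℝ E] (l : ℝ) (u : ℝ → E) : Prop :=
  ∃ v : ℝ → E, MemLp v 2 (edgeMeasure l) ∧ ∀ t ∈ Icc 0 l, u t = u 0 + ∫ s in (0 : ℝ)..t, v s

/-- `u` is (the `C¹` representative of) an element of `H²[0, l]`. -/
def MemH2 (l : ℝ) (u : ℝ → ℂ) : Prop :=
  DifferentiableOn ℝ u (Icc 0 l) ∧ MemH1 l (edgeDeriv l u)

theorem MemH1.ae_differentiable {E : Type*} [NormedAddCommGroup E] [NormedSpace ℝ E]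
    [CompleteSpace E] {l : ℝ} {u : ℝ → E} (h : MemH1 l u) :
    ∀ᵐ t ∂(edgeMeasure l), DifferentiableWithinAt ℝ u (Icc 0 l) t := by
  obtain ⟨v, hv, hu⟩ := h
  rcases lt_or_ge l 0 with hl | hl
  · simp [edgeMeasure, Icc_eq_empty (not_le.mpr hl)]
  have hint : IntervalIntegrable v volume 0 l := by
    rw [intervalIntegrable_iff_integrableOn_Icc_of_le hl]
    exact hv.integrable (by norm_num)
  rw [ae_restrict_iff' measurableSet_Icc]
  filter_upwards [hint.ae_hasDerivAt_integral] with t ht htI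
  rw [uIcc_of_le hl] at ht
  have h1 := (ht htI 0 ⟨le_rfl, hl⟩).differentiableAt.differentiableWithinAt (s := Icc 0 l)
  exact (h1.const_add (u 0)).congr (fun s hs => hu s hs) (hu t htI)

theorem edgeDeriv_congr {E : Type*} [NormedAddCommGroup E] [NormedSpace ℝ E] {l : ℝ}
    {u v : ℝ → E} (h : EqOn u v (Icc 0 l)) : EqOn (edgeDeriv l u) (edgeDeriv l v) (Icc 0 l) :=
  fun _ ht => derivWithin_congr h (h ht)

theorem MemH1.congr {E : Type*} [NormedAddCommGroup E] [NormedSpace ℝ E] {l : ℝ}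
    {u v : ℝ → E} (hu : MemH1 l u) (h : EqOn v u (Icc 0 l)) : MemH1 l v := by
  obtain ⟨w, hw, hw'⟩ := hu
  refine ⟨w, hw, fun t ht => ?_⟩
  rw [h ht, h ⟨le_rfl, ht.1.trans ht.2⟩, hw' t ht]

theorem MemH1.const_add {E : Type*} [NormedAddCommGroup E] [NormedSpace ℝ E] {l : ℝ}
    {u : ℝ → E} (hu : MemH1 l u) (c : E) : MemH1 l (fun t => c + u t) := by
  obtain ⟨w, hw, hw'⟩ := hu
  refine ⟨w, hw, fun t ht => ?_⟩
  change c + u t = c + u 0 + _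
  rw [hw' t ht, add_assoc]

theorem MemH1.add {l : ℝ} {u v : ℝ → ℂ} (hu : MemH1 l u) (hv : MemH1 l v) :
    MemH1 l (u + v) := by
  obtain ⟨w, hw, hw'⟩ := hu
  obtain ⟨x, hx, hx'⟩ := hv
  refine ⟨w + x, hw.add hx, fun t ht => ?_⟩
  have hi : ∀ f : ℝ → ℂ, MemLp f 2 (edgeMeasure l) → IntervalIntegrable f volume 0 t := by
    intro f hf
    rw [intervalIntegrable_iff_integrableOn_Icc_of_le ht.1]
    have h1 : IntegrableOn f (Icc 0 l) volume := hf.integrable (by norm_num)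
    exact h1.mono_set (Icc_subset_Icc le_rfl ht.2)
  simp only [Pi.add_apply]
  rw [intervalIntegral.integral_add (hi w hw) (hi x hx), hw' t ht, hx' t ht]
  ring

theorem MemH1.smul {l : ℝ} {u : ℝ → ℂ} (hu : MemH1 l u) (c : ℂ) : MemH1 l (c • u) := by
  obtain ⟨w, hw, hw'⟩ := hu
  refine ⟨c • w, hw.const_smul c, fun t ht => ?_⟩
  simp only [Pi.smul_apply]
  rw [intervalIntegral.integral_smul, hw' t ht, smul_add]

theorem edgeDeriv_add {l : ℝ} {u v : ℝ → ℂ} (hu : DifferentiableOn ℝ u (Icc 0 l))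
    (hv : DifferentiableOn ℝ v (Icc 0 l)) :
    EqOn (edgeDeriv l (u + v)) (edgeDeriv l u + edgeDeriv l v) (Icc 0 l) :=
  fun t ht => derivWithin_add (hu t ht) (hv t ht)

theorem edgeDeriv_smul {l : ℝ} {u : ℝ → ℂ} (hu : DifferentiableOn ℝ u (Icc 0 l)) (c : ℂ) :
    EqOn (edgeDeriv l (c • u)) (c • edgeDeriv l u) (Icc 0 l) :=
  fun t ht => derivWithin_const_smul c (hu t ht)

theorem MemH2.add {l : ℝ} {u v : ℝ → ℂ} (hu : MemH2 l u) (hv : MemH2 l v) : MemH2 l (u + v) :=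
  ⟨hu.1.add hv.1, (hu.2.add hv.2).congr (edgeDeriv_add hu.1 hv.1)⟩

theorem MemH2.smul {l : ℝ} {u : ℝ → ℂ} (hu : MemH2 l u) (c : ℂ) : MemH2 l (c • u) :=
  ⟨hu.1.const_smul c, (hu.2.smul c).congr (edgeDeriv_smul hu.1 c)⟩

/-! ### The differential expressions on an edge -/

/-- The kinetic momentum `(-i d/dt - A) u`. -/
def momentum (l : ℝ) (A : ℝ → ℝ) (u : ℝ → ℂ) : ℝ → ℂ :=
  fun t => -Complex.I * edgeDeriv l u t - (A t : ℂ) * u t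

/-- The magnetic Schrödinger expression `(-i d/dt - A)² u + V u`. -/
def magneticSchrodinger (l : ℝ) (A V : ℝ → ℝ) (u : ℝ → ℂ) : ℝ → ℂ :=
  fun t => momentum l A (momentum l A u) t + (V t : ℂ) * u t

/-- The magnetic derivative `(d/dt - i A) u`. -/
def covDeriv (l : ℝ) (A : ℝ → ℝ) (u : ℝ → ℂ) : ℝ → ℂ :=
  fun t => edgeDeriv l u t - Complex.I * (A t : ℂ) * u t

/-- The Schrödinger expression `-u'' + V u` without magnetic field. -/
def schrodinger (l : ℝ) (V : ℝ → ℝ) (u : ℝ → ℂ) : ℝ → ℂ :=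
  fun t => -edgeDeriv l (edgeDeriv l u) t + (V t : ℂ) * u t

theorem momentum_congr {l : ℝ} {A : ℝ → ℝ} {u v : ℝ → ℂ} (h : EqOn u v (Icc 0 l)) :
    EqOn (momentum l A u) (momentum l A v) (Icc 0 l) := fun t ht => by
  simp only [momentum, h ht, edgeDeriv_congr h ht]

theorem magneticSchrodinger_congr {l : ℝ} {A V : ℝ → ℝ} {u v : ℝ → ℂ} (h : EqOn u v (Icc 0 l)) :
    EqOn (magneticSchrodinger l A V u) (magneticSchrodinger l A V v) (Icc 0 l) := fun t ht => by
  simp only [magneticSchrodinger, h ht, momentum_congr (momentum_congr h) ht]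

theorem schrodinger_congr {l : ℝ} {V : ℝ → ℝ} {u v : ℝ → ℂ} (h : EqOn u v (Icc 0 l)) :
    EqOn (schrodinger l V u) (schrodinger l V v) (Icc 0 l) := fun t ht => by
  simp only [schrodinger, h ht, edgeDeriv_congr (edgeDeriv_congr h) ht]

theorem covDeriv_add {l : ℝ} {A : ℝ → ℝ} {u v : ℝ → ℂ} (hu : MemH2 l u) (hv : MemH2 l v) :
    EqOn (covDeriv l A (u + v)) (covDeriv l A u + covDeriv l A v) (Icc 0 l) := fun t ht => by
  simp only [covDeriv, edgeDeriv_add hu.1 hv.1 ht, Pi.add_apply]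
  ring

theorem covDeriv_smul {l : ℝ} {A : ℝ → ℝ} {u : ℝ → ℂ} (hu : MemH2 l u) (c : ℂ) :
    EqOn (covDeriv l A (c • u)) (c • covDeriv l A u) (Icc 0 l) := fun t ht => by
  simp only [covDeriv, edgeDeriv_smul hu.1 c ht, Pi.smul_apply, smul_eq_mul]
  ring

theorem momentum_add {l : ℝ} {A : ℝ → ℝ} {u v : ℝ → ℂ} (hu : MemH2 l u) (hv : MemH2 l v) :
    EqOn (momentum l A (u + v)) (momentum l A u + momentum l A v) (Icc 0 l) := fun t ht => by
  simp only [momentum, edgeDeriv_add hu.1 hv.1 ht, Pi.add_apply]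
  ring

theorem momentum_smul {l : ℝ} {A : ℝ → ℝ} {u : ℝ → ℂ} (hu : MemH2 l u) (c : ℂ) :
    EqOn (momentum l A (c • u)) (c • momentum l A u) (Icc 0 l) := fun t ht => by
  simp only [momentum, edgeDeriv_smul hu.1 c ht, Pi.smul_apply, smul_eq_mul]
  ring

theorem ae_mem_edge (l : ℝ) : ∀ᵐ t ∂(edgeMeasure l), t ∈ Icc 0 l :=
  ae_restrict_mem measurableSet_Icc

theorem ae_differentiable_momentum {l : ℝ} {A : ℝ → ℝ} (hA : MemH1 l A) {u : ℝ → ℂ}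
    (hu : MemH2 l u) :
    ∀ᵐ t ∂(edgeMeasure l), DifferentiableWithinAt ℝ (momentum l A u) (Icc 0 l) t := by
  filter_upwards [hA.ae_differentiable, hu.2.ae_differentiable, ae_mem_edge l] with t h1 h2 ht
  have h3 : DifferentiableWithinAt ℝ (fun s => (A s : ℂ)) (Icc 0 l) t :=
    Complex.ofRealCLM.differentiableAt.comp_differentiableWithinAt t h1
  exact (h2.const_mul _).sub (h3.mul (hu.1 t ht))

theorem magneticSchrodinger_add {l : ℝ} {A V : ℝ → ℝ} (hA : MemH1 l A) {u v : ℝ → ℂ}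
    (hu : MemH2 l u) (hv : MemH2 l v) :
    magneticSchrodinger l A V (u + v) =ᵐ[edgeMeasure l]
      magneticSchrodinger l A V u + magneticSchrodinger l A V v := by
  filter_upwards [ae_differentiable_momentum hA hu, ae_differentiable_momentum hA hv,
    ae_mem_edge l] with t h1 h2 ht
  have h3 := momentum_congr (A := A) (momentum_add (A := A) hu hv) ht
  have h4 : edgeDeriv l (momentum l A u + momentum l A v) t
      = edgeDeriv l (momentum l A u) t + edgeDeriv l (momentum l A v) t := derivWithin_add h1 h2
  simp only [magneticSchrodinger, h3, Pi.add_apply]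
  rw [momentum, h4]
  simp only [momentum, Pi.add_apply]
  ring

theorem magneticSchrodinger_smul {l : ℝ} {A V : ℝ → ℝ} (hA : MemH1 l A) {u : ℝ → ℂ}
    (hu : MemH2 l u) (c : ℂ) :
    magneticSchrodinger l A V (c • u) =ᵐ[edgeMeasure l] c • magneticSchrodinger l A V u := by
  filter_upwards [ae_differentiable_momentum hA hu, ae_mem_edge l] with t h1 ht
  have h3 := momentum_congr (A := A) (momentum_smul (A := A) hu c) ht
  have h4 : edgeDeriv l (c • momentum l A u) t = c • edgeDeriv l (momentum l A u) t :=
    derivWithin_const_smul c h1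
  simp only [magneticSchrodinger, h3, Pi.smul_apply]
  rw [momentum, h4]
  simp only [momentum, Pi.smul_apply, smul_eq_mul]
  ring

theorem schrodinger_add {l : ℝ} {V : ℝ → ℝ} {u v : ℝ → ℂ} (hu : MemH2 l u) (hv : MemH2 l v) :
    schrodinger l V (u + v) =ᵐ[edgeMeasure l] schrodinger l V u + schrodinger l V v := by
  filter_upwards [hu.2.ae_differentiable, hv.2.ae_differentiable, ae_mem_edge l] with t h1 h2 ht
  have h3 := edgeDeriv_congr (edgeDeriv_add hu.1 hv.1) ht
  have h4 : edgeDeriv l (edgeDeriv l u + edgeDeriv l v) t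
      = edgeDeriv l (edgeDeriv l u) t + edgeDeriv l (edgeDeriv l v) t := derivWithin_add h1 h2
  simp only [schrodinger, h3, h4, Pi.add_apply]
  ring

theorem schrodinger_smul {l : ℝ} {V : ℝ → ℝ} {u : ℝ → ℂ} (hu : MemH2 l u) (c : ℂ) :
    schrodinger l V (c • u) =ᵐ[edgeMeasure l] c • schrodinger l V u := by
  filter_upwards [hu.2.ae_differentiable, ae_mem_edge l] with t h1 ht
  have h3 := edgeDeriv_congr (edgeDeriv_smul hu.1 c) ht
  have h4 : edgeDeriv l (c • edgeDeriv l u) t = c • edgeDeriv l (edgeDeriv l u) t :=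
    derivWithin_const_smul c h1
  simp only [schrodinger, h3, h4, Pi.smul_apply, smul_eq_mul]
  ring

theorem edgeDeriv_zero (l : ℝ) : edgeDeriv l (0 : ℝ → ℂ) = 0 := by
  funext t
  simp [edgeDeriv]

theorem momentum_zero (l : ℝ) (A : ℝ → ℝ) : momentum l A 0 = 0 := by
  funext t
  simp [momentum, edgeDeriv_zero]

theorem memH2_zero (l : ℝ) : MemH2 l 0 := by
  refine ⟨differentiableOn_const 0, 0, MemLp.zero, fun t _ => ?_⟩
  simp [edgeDeriv_zero]

theorem eqOn_of_ae_eq {l : ℝ} (hl : 0 < l) {u v : ℝ → ℂ} (hu : MemH2 l u) (hv : MemH2 l v)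
    (h : u =ᵐ[edgeMeasure l] v) : EqOn u v (Icc 0 l) :=
  Measure.eqOn_Icc_of_ae_eq volume hl.ne h hu.1.continuousOn hv.1.continuousOn

/-! ### The lattice, the magnetic field and its vector potential -/

/-- The two directions of the edges. -/
inductive Dir
  | right
  | up

/-- The edge `(m, n, right)` joins the node `(m l, n l)` to `((m + 1) l, n l)`; the edge
`(m, n, up)` joins `(m l, n l)` to `(m l, (n + 1) l)`. -/
abbrev Edge : Type := ℤ × ℤ × Dir

/-- `L²[0, l]`. -/
abbrev EdgeSpace (l : ℝ) : Type := Lp ℂ 2 (edgeMeasure l)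

/-- The Hilbert sum of the spaces `L²[0, l]` over all edges. -/
abbrev LatticeSpace (l : ℝ) : Type := lp (fun _ : Edge => EdgeSpace l) 2

/-- `ξ = (2 π l²)⁻¹ ∫_F b`, where `F` is the fundamental cell `[0, l] × [0, l]`. -/
def fluxDensity (l : ℝ) (b : ℝ × ℝ → ℝ) : ℝ :=
  1 / (2 * Real.pi * l ^ 2) * ∫ x in Icc (0 : ℝ) l ×ˢ Icc (0 : ℝ) l, b x

/-- A continuous magnetic field `b`, `l`-periodic in both variables, together with a continuous
`l`-periodic vector potential `(A₁, A₂)` of its zero-mean part `b - 2 π ξ`. The equation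
`∂₁ A₂ - ∂₂ A₁ = b - 2 π ξ` is meant in the sense of distributions. The traces of the potential on
the edges belong to `H¹`, so that `(-i d/dt - A)²` makes sense on `H²[0, l]`; this is automatic
for a `C¹` potential. -/
structure PeriodicMagneticField (l : ℝ) where
  b : ℝ × ℝ → ℝ
  b_continuous : Continuous b
  b_periodic_fst : ∀ x y, b (x + l, y) = b (x, y)
  b_periodic_snd : ∀ x y, b (x, y + l) = b (x, y)
  A₁ : ℝ × ℝ → ℝ
  A₂ : ℝ × ℝ → ℝ
  A₁_continuous : Continuous A₁
  A₂_continuous : Continuous A₂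
  A₁_periodic_fst : ∀ x y, A₁ (x + l, y) = A₁ (x, y)
  A₁_periodic_snd : ∀ x y, A₁ (x, y + l) = A₁ (x, y)
  A₂_periodic_fst : ∀ x y, A₂ (x + l, y) = A₂ (x, y)
  A₂_periodic_snd : ∀ x y, A₂ (x, y + l) = A₂ (x, y)
  curl_eq : ∀ φ : ℝ × ℝ → ℝ, ContDiff ℝ ∞ φ → HasCompactSupport φ →
    ∫ x, (A₁ x * fderiv ℝ φ x (0, 1) - A₂ x * fderiv ℝ φ x (1, 0))
      = ∫ x, (b x - 2 * Real.pi * fluxDensity l b) * φ x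
  trace_right : MemH1 l (fun t => A₁ (t, 0))
  trace_up : MemH1 l (fun t => A₂ (0, t))

namespace PeriodicMagneticField

variable {l : ℝ}

/-- The mean flux density `ξ`. -/
def xi (F : PeriodicMagneticField l) : ℝ := fluxDensity l F.b

/-- The number `θ = ξ l²` of flux quanta through the elementary cell. -/
def theta (F : PeriodicMagneticField l) : ℝ := F.xi * l ^ 2

/-- The vector potential `A(x) = ½ B₀ × x + (A₁, A₂)`, `B₀ = (0, 0, 2 π ξ)`, in the plane. -/
def potential (F : PeriodicMagneticField l) (x : ℝ × ℝ) : ℝ × ℝ :=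
  (-(Real.pi * F.xi * x.2) + F.A₁ x, Real.pi * F.xi * x.1 + F.A₂ x)

/-- The magnetic potential on an edge: the tangential component of the vector potential. -/
def edgePotential (F : PeriodicMagneticField l) : Edge → ℝ → ℝ
  | (m, n, Dir.right) => fun t => (F.potential (m * l + t, n * l)).1
  | (m, n, Dir.up) => fun t => (F.potential (m * l, n * l + t)).2

theorem edgePotential_right (F : PeriodicMagneticField l) (m n : ℤ) (t : ℝ) :
    F.edgePotential (m, n, Dir.right) t = -(Real.pi * F.xi * (n * l)) + F.A₁ (t, 0) := by
  have h1 : Function.Periodic (fun x => F.A₁ (x, n * l)) l := fun x => F.A₁_periodic_fst x _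
  have h2 : Function.Periodic (fun y => F.A₁ (t, y)) l := fun y => F.A₁_periodic_snd t y
  have h3 := h1.int_mul m t
  have h4 := h2.int_mul n 0
  simp only [zero_add] at h3 h4
  simp only [edgePotential, potential]
  rw [add_comm ((m : ℝ) * l) t, h3, h4]

theorem edgePotential_up (F : PeriodicMagneticField l) (m n : ℤ) (t : ℝ) :
    F.edgePotential (m, n, Dir.up) t = Real.pi * F.xi * (m * l) + F.A₂ (0, t) := by
  have h1 : Function.Periodic (fun y => F.A₂ (m * l, y)) l := fun y => F.A₂_periodic_snd _ y
  have h2 : Function.Periodic (fun x => F.A₂ (x, t)) l := fun x => F.A₂_periodic_fst x t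
  have h3 := h1.int_mul n t
  have h4 := h2.int_mul m 0
  simp only [zero_add] at h3 h4
  simp only [edgePotential, potential]
  rw [add_comm ((n : ℝ) * l) t, h3, h4]

theorem memH1_edgePotential (F : PeriodicMagneticField l) (e : Edge) :
    MemH1 l (F.edgePotential e) := by
  obtain ⟨m, n, d⟩ := e
  cases d
  · exact (F.trace_right.const_add _).congr fun t _ => F.edgePotential_right m n t
  · exact (F.trace_up.const_add _).congr fun t _ => F.edgePotential_up m n t

end PeriodicMagneticField

/-! ### The magnetic Hamiltonian of the lattice -/

/-- The boundary conditions at the nodes: the `δ`-like interaction with parameters `α`, `β`.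
The common value `f_{m,n}` at the node is written as the value of the right edge. -/
structure VertexConditions {l : ℝ} (F : PeriodicMagneticField l) (α β : ℝ)
    (u : Edge → ℝ → ℂ) : Prop where
  up_start : ∀ m n : ℤ, 1 / (β : ℂ) * u (m, n, Dir.up) 0 = u (m, n, Dir.right) 0
  right_end : ∀ m n : ℤ, u (m - 1, n, Dir.right) l = u (m, n, Dir.right) 0
  up_end : ∀ m n : ℤ, 1 / (β : ℂ) * u (m, n - 1, Dir.up) l = u (m, n, Dir.right) 0
  flux : ∀ m n : ℤ,
    covDeriv l (F.edgePotential (m, n, Dir.right)) (u (m, n, Dir.right)) 0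
      + β * covDeriv l (F.edgePotential (m, n, Dir.up)) (u (m, n, Dir.up)) 0
      - covDeriv l (F.edgePotential (m - 1, n, Dir.right)) (u (m - 1, n, Dir.right)) l
      - β * covDeriv l (F.edgePotential (m, n - 1, Dir.up)) (u (m, n - 1, Dir.up)) l
    = α * u (m, n, Dir.right) 0

/-- `(f, g)` is in the graph of the lattice Hamiltonian: the components of `f` are `H²` functions
`u e` satisfying the boundary conditions, and the components of `g` are
`(-i d/dt - A_e)² u_e + V u_e`. -/
def IsHamiltonianPair {l : ℝ} (F : PeriodicMagneticField l) (V : ℝ → ℝ) (α β : ℝ)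
    (f g : LatticeSpace l) : Prop :=
  ∃ u : Edge → ℝ → ℂ,
    (∀ e, MemH2 l (u e)) ∧
    VertexConditions F α β u ∧
    (∀ e, f e =ᵐ[edgeMeasure l] u e) ∧
    (∀ e, g e =ᵐ[edgeMeasure l] magneticSchrodinger l (F.edgePotential e) V (u e))

theorem VertexConditions.add {l : ℝ} (hl : 0 ≤ l) {F : PeriodicMagneticField l} {α β : ℝ}
    {u v : Edge → ℝ → ℂ} (hu2 : ∀ e, MemH2 l (u e)) (hv2 : ∀ e, MemH2 l (v e))
    (hu : VertexConditions F α β u) (hv : VertexConditions F α β v) :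
    VertexConditions F α β (fun e => u e + v e) where
  up_start m n := by simp only [Pi.add_apply, mul_add, hu.up_start, hv.up_start]
  right_end m n := by simp only [Pi.add_apply, hu.right_end, hv.right_end]
  up_end m n := by simp only [Pi.add_apply, mul_add, hu.up_end, hv.up_end]
  flux m n := by
    have h0 : (0 : ℝ) ∈ Icc 0 l := ⟨le_rfl, hl⟩
    have h1 : l ∈ Icc 0 l := ⟨hl, le_rfl⟩
    simp only [covDeriv_add (hu2 _) (hv2 _) h0, covDeriv_add (hu2 _) (hv2 _) h1, Pi.add_apply]
    linear_combination hu.flux m n + hv.flux m n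

theorem VertexConditions.smul {l : ℝ} (hl : 0 ≤ l) {F : PeriodicMagneticField l} {α β : ℝ}
    {u : Edge → ℝ → ℂ} (hu2 : ∀ e, MemH2 l (u e))
    (hu : VertexConditions F α β u) (c : ℂ) :
    VertexConditions F α β (fun e => c • u e) where
  up_start m n := by
    simp only [Pi.smul_apply, smul_eq_mul]
    linear_combination c * hu.up_start m n
  right_end m n := by simp only [Pi.smul_apply, hu.right_end]
  up_end m n := by
    simp only [Pi.smul_apply, smul_eq_mul]
    linear_combination c * hu.up_end m n
  flux m n := by
    have h0 : (0 : ℝ) ∈ Icc 0 l := ⟨le_rfl, hl⟩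
    have h1 : l ∈ Icc 0 l := ⟨hl, le_rfl⟩
    simp only [covDeriv_smul (hu2 _) c h0, covDeriv_smul (hu2 _) c h1, Pi.smul_apply, smul_eq_mul]
    linear_combination c * hu.flux m n

/-- The graph of the lattice Hamiltonian as a linear subspace. -/
def hamiltonianGraph {l : ℝ} (hl : 0 < l) (F : PeriodicMagneticField l) (V : ℝ → ℝ) (α β : ℝ) :
    Submodule ℂ (LatticeSpace l × LatticeSpace l) where
  carrier := {p | IsHamiltonianPair F V α β p.1 p.2}
  zero_mem' := by
    refine ⟨fun _ => 0, fun _ => memH2_zero l, ⟨?_, ?_, ?_, ?_⟩, fun e => ?_, fun e => ?_⟩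
    · simp
    · simp
    · simp
    · simp [covDeriv, edgeDeriv_zero]
    · exact Lp.coeFn_zero ℂ 2 (edgeMeasure l)
    · refine (Lp.coeFn_zero ℂ 2 (edgeMeasure l)).trans (Filter.Eventually.of_forall fun t => ?_)
      simp [magneticSchrodinger, momentum_zero]
  add_mem' := by
    rintro ⟨f, g⟩ ⟨f', g'⟩ ⟨u, hu, hb, hf, hg⟩ ⟨u', hu', hb', hf', hg'⟩
    refine ⟨fun e => u e + u' e, fun e => (hu e).add (hu' e), hb.add hl.le hu hu' hb',
      fun e => ?_, fun e => ?_⟩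
    · exact (Lp.coeFn_add (f e) (f' e)).trans ((hf e).add (hf' e))
    · exact ((Lp.coeFn_add (g e) (g' e)).trans ((hg e).add (hg' e))).trans
        (magneticSchrodinger_add (F.memH1_edgePotential e) (hu e) (hu' e)).symm
  smul_mem' := by
    rintro c ⟨f, g⟩ ⟨u, hu, hb, hf, hg⟩
    refine ⟨fun e => c • u e, fun e => (hu e).smul c, hb.smul hl.le hu c, fun e => ?_, fun e => ?_⟩
    · exact (Lp.coeFn_smul c (f e)).trans ((hf e).const_smul c)
    · exact ((Lp.coeFn_smul c (g e)).trans ((hg e).const_smul c)).trans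
        (magneticSchrodinger_smul (F.memH1_edgePotential e) (hu e) c).symm

/-- The magnetic Hamiltonian `L` of the lattice, an unbounded operator. -/
def hamiltonian {l : ℝ} (hl : 0 < l) (F : PeriodicMagneticField l) (V : ℝ → ℝ) (α β : ℝ) :
    LatticeSpace l →ₗ.[ℂ] LatticeSpace l :=
  (hamiltonianGraph hl F V α β).toLinearPMap

theorem hamiltonian_graph {l : ℝ} (hl : 0 < l) (F : PeriodicMagneticField l) (V : ℝ → ℝ)
    (α β : ℝ) : (hamiltonian hl F V α β).graph = hamiltonianGraph hl F V α β := by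
  refine Submodule.toLinearPMap_graph_eq _ ?_
  rintro ⟨f, g⟩ ⟨u, hu, -, hf, hg⟩ (h0 : f = 0)
  subst h0
  refine lp.ext (funext fun e => Lp.ext ?_)
  have h1 : EqOn (u e) 0 (Icc 0 l) := by
    refine eqOn_of_ae_eq hl (hu e) (memH2_zero l) ?_
    exact (hf e).symm.trans (Lp.coeFn_zero ℂ 2 (edgeMeasure l))
  refine (hg e).trans (Filter.EventuallyEq.trans ?_ (Lp.coeFn_zero ℂ 2 (edgeMeasure l)).symm)
  filter_upwards [ae_mem_edge l] with t ht
  rw [magneticSchrodinger_congr h1 ht]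
  simp [magneticSchrodinger, momentum_zero]

/-! ### The Dirichlet operator on an edge -/

/-- `(f, g)` is in the graph of the Dirichlet operator `D`. -/
def IsDirichletPair {l : ℝ} (V : ℝ → ℝ) (f g : EdgeSpace l) : Prop :=
  ∃ u : ℝ → ℂ, MemH2 l u ∧ u 0 = 0 ∧ u l = 0 ∧ f =ᵐ[edgeMeasure l] u ∧
    g =ᵐ[edgeMeasure l] schrodinger l V u

/-- The graph of the Dirichlet operator as a linear subspace. -/
def dirichletGraph (l : ℝ) (V : ℝ → ℝ) : Submodule ℂ (EdgeSpace l × EdgeSpace l) where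
  carrier := {p | IsDirichletPair V p.1 p.2}
  zero_mem' := by
    refine ⟨0, memH2_zero l, rfl, rfl, Lp.coeFn_zero ℂ 2 (edgeMeasure l), ?_⟩
    refine (Lp.coeFn_zero ℂ 2 (edgeMeasure l)).trans (Filter.Eventually.of_forall fun t => ?_)
    simp [schrodinger, edgeDeriv_zero]
  add_mem' := by
    rintro ⟨f, g⟩ ⟨f', g'⟩ ⟨u, hu, h0, h1, hf, hg⟩ ⟨u', hu', h0', h1', hf', hg'⟩
    refine ⟨u + u', hu.add hu', by simp [h0, h0'], by simp [h1, h1'], ?_, ?_⟩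
    · exact (Lp.coeFn_add f f').trans (hf.add hf')
    · exact ((Lp.coeFn_add g g').trans (hg.add hg')).trans (schrodinger_add hu hu').symm
  smul_mem' := by
    rintro c ⟨f, g⟩ ⟨u, hu, h0, h1, hf, hg⟩
    refine ⟨c • u, hu.smul c, by simp [h0], by simp [h1], ?_, ?_⟩
    · exact (Lp.coeFn_smul c f).trans (hf.const_smul c)
    · exact ((Lp.coeFn_smul c g).trans (hg.const_smul c)).trans (schrodinger_smul hu c).symm

/-- The Dirichlet operator `D f = -f'' + V f`, `f ∈ H²[0, l]`, `f(0) = f(l) = 0`. -/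
def dirichletOperator (l : ℝ) (V : ℝ → ℝ) : EdgeSpace l →ₗ.[ℂ] EdgeSpace l :=
  (dirichletGraph l V).toLinearPMap

theorem dirichletOperator_graph {l : ℝ} (hl : 0 < l) (V : ℝ → ℝ) :
    (dirichletOperator l V).graph = dirichletGraph l V := by
  refine Submodule.toLinearPMap_graph_eq _ ?_
  rintro ⟨f, g⟩ ⟨u, hu, -, -, hf, hg⟩ (h0 : f = 0)
  subst h0
  refine Lp.ext ?_
  have h1 : EqOn u 0 (Icc 0 l) := by
    refine eqOn_of_ae_eq hl hu (memH2_zero l) ?_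
    exact hf.symm.trans (Lp.coeFn_zero ℂ 2 (edgeMeasure l))
  refine hg.trans (Filter.EventuallyEq.trans ?_ (Lp.coeFn_zero ℂ 2 (edgeMeasure l)).symm)
  filter_upwards [ae_mem_edge l] with t ht
  rw [schrodinger_congr h1 ht]
  simp [schrodinger, edgeDeriv_zero]

/-! ### The spectrum of an unbounded operator -/

/-- The resolvent set of an unbounded operator `T`: the numbers `z` for which `T - z` maps the
domain of `T` bijectively onto the whole space, with a bounded inverse `R`. -/
def resolventSet {H : Type*} [NormedAddCommGroup H] [NormedSpace ℂ H] (T : H →ₗ.[ℂ] H) : Set ℂ :=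
  {z | ∃ R : H →L[ℂ] H, (∀ x : T.domain, R (T x - z • (x : H)) = x) ∧
    ∀ y : H, ∃ h : R y ∈ T.domain, T ⟨R y, h⟩ - z • R y = y}

/-- The spectrum of an unbounded operator. -/
def unboundedSpectrum {H : Type*} [NormedAddCommGroup H] [NormedSpace ℂ H] (T : H →ₗ.[ℂ] H) :
    Set ℂ :=
  (resolventSet T)ᶜ

/-! ### The Krein matrix of an edge -/

/-- `u ∈ H²[0, l]`, `-u'' + V u = z u`, `u(0) = c₀`, `u'(0) = c₁`. -/
def IsSolution (l : ℝ) (V : ℝ → ℝ) (z c₀ c₁ : ℂ) (u : ℝ → ℂ) : Prop :=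
  MemH2 l u ∧ (∀ᵐ t ∂(edgeMeasure l), schrodinger l V u t = z * u t) ∧
    u 0 = c₀ ∧ edgeDeriv l u 0 = c₁

open Classical in
/-- The solution of this initial value problem, which exists and is unique on `[0, l]` for
`V ∈ L²[0, l]`. -/
def solution (l : ℝ) (V : ℝ → ℝ) (z c₀ c₁ : ℂ) : ℝ → ℂ :=
  if h : ∃ u, IsSolution l V z c₀ c₁ u then h.choose else 0

/-- The solution `u₁` with `u₁(0; z) = 0`, `u₁'(0; z) = 1`. -/
def u₁ (l : ℝ) (V : ℝ → ℝ) (z : ℂ) : ℝ → ℂ := solution l V z 0 1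

/-- The solution `u₂` with `u₂(0; z) = 1`, `u₂'(0; z) = 0`. -/
def u₂ (l : ℝ) (V : ℝ → ℝ) (z : ℂ) : ℝ → ℂ := solution l V z 1 0

/-- The Krein matrix `s(z)`, which takes `(f(0), f(l))` to `(f'(0), -f'(l))` for the solutions of
`-f'' + V f = z f`. -/
def kreinMatrix (l : ℝ) (V : ℝ → ℝ) (z : ℂ) : Matrix (Fin 2) (Fin 2) ℂ :=
  (1 / u₁ l V z l) • !![-u₂ l V z l, 1; 1, -edgeDeriv l (u₁ l V z) l]

/-! ### The discrete magnetic Laplacian -/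

/-- `ℓ²(ℤ²)`. -/
abbrev L2Z2 : Type := lp (fun _ : ℤ × ℤ => ℂ) 2

/-- The operator `(W g)(p) = exp(i c(p)) g(e p)` on `ℓ²(ℤ²)`. -/
def magneticShift (e : ℤ × ℤ ≃ ℤ × ℤ) (c : ℤ × ℤ → ℝ) : L2Z2 →L[ℂ] L2Z2 :=
  have key : ∀ (g : L2Z2) (p : ℤ × ℤ),
      ‖Complex.exp (Complex.I * c p) * g (e p)‖ ^ (2 : ENNReal).toReal
        = ‖g (e p)‖ ^ (2 : ENNReal).toReal := fun g p => by
    rw [norm_mul, mul_comm Complex.I, Complex.norm_exp_ofReal_mul_I, one_mul]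
  have hpos : 0 < (2 : ENNReal).toReal := by norm_num
  LinearMap.mkContinuous
    { toFun := fun g => ⟨fun p => Complex.exp (Complex.I * c p) * g (e p), by
        refine memℓp_gen ?_
        simp only [key]
        exact e.summable_iff.mpr ((lp.memℓp g).summable hpos)⟩
      map_add' := fun g h => lp.ext (funext fun p => mul_add _ _ _)
      map_smul' := fun a g => lp.ext (funext fun p => mul_left_comm _ _ _) }
    1 (fun g => by
      rw [one_mul, lp.norm_eq_tsum_rpow hpos, lp.norm_eq_tsum_rpow hpos]
      refine le_of_eq (congrArg (fun x : ℝ => x ^ (1 / (2 : ENNReal).toReal)) ?_)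
      refine (tsum_congr fun p => key g p).trans ?_
      exact e.tsum_eq (fun q => ‖g q‖ ^ (2 : ENNReal).toReal))

theorem magneticShift_apply (e : ℤ × ℤ ≃ ℤ × ℤ) (c : ℤ × ℤ → ℝ) (g : L2Z2) (p : ℤ × ℤ) :
    magneticShift e c g p = Complex.exp (Complex.I * c p) * g (e p) := rfl

/-- The discrete magnetic Laplacian `M(θ, β)`, a bounded operator on `ℓ²(ℤ²)`. -/
def discreteMagneticLaplacian (θ β : ℝ) : L2Z2 →L[ℂ] L2Z2 :=
  magneticShift (Equiv.addRight (1, 0)) (fun p => Real.pi * p.2 * θ)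
    + magneticShift (Equiv.addRight (-1, 0)) (fun p => -(Real.pi * p.2 * θ))
    + (β ^ 2 : ℂ) • (magneticShift (Equiv.addRight (0, 1)) (fun p => -(Real.pi * p.1 * θ))
      + magneticShift (Equiv.addRight (0, -1)) (fun p => Real.pi * p.1 * θ))

theorem discreteMagneticLaplacian_apply (θ β : ℝ) (g : L2Z2) (m n : ℤ) :
    discreteMagneticLaplacian θ β g (m, n)
      = Complex.exp (Complex.I * Real.pi * n * θ) * g (m + 1, n)
        + Complex.exp (-(Complex.I * Real.pi * n * θ)) * g (m - 1, n)
        + β ^ 2 * (Complex.exp (-(Complex.I * Real.pi * m * θ)) * g (m, n + 1)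
          + Complex.exp (Complex.I * Real.pi * m * θ) * g (m, n - 1)) := by
  have h : discreteMagneticLaplacian θ β g (m, n)
      = magneticShift (Equiv.addRight (1, 0)) (fun p => Real.pi * p.2 * θ) g (m, n)
    + magneticShift (Equiv.addRight (-1, 0)) (fun p => -(Real.pi * p.2 * θ)) g (m, n)
    + (β ^ 2 : ℂ) * (magneticShift (Equiv.addRight (0, 1)) (fun p => -(Real.pi * p.1 * θ)) g (m, n)
      + magneticShift (Equiv.addRight (0, -1)) (fun p => Real.pi * p.1 * θ) g (m, n)) := rfl
  rw [h]
  simp only [magneticShift_apply, Equiv.coe_addRight, Prod.mk_add_mk, add_zero, ← sub_eq_add_neg]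
  push_cast
  simp only [mul_neg, mul_assoc]

end QuantumGraph

end

noncomputable section

namespace QuantumGraph

/-! ### Calculus of Sobolev functions on a segment -/

section Calculus

variable {E : Type*} [NormedAddCommGroup E] [NormedSpace ℝ E] {l : ℝ}

/-! The argument is Krein's resolvent formula, with the values at the nodes as boundary space.

Gauge. On each edge the factor `exp (i P)` with `P' = A` turns `d/dt - iA` into `d/dt`. The constant
in `P` is fixed by node phases linear in `(m, n)`. The periodic part of the potential then
disappears completely. What survives is the linear part, whose integral along an edge contributes
`-π n θ` (horizontal) or `π m θ` (vertical). These mismatches at the final nodes are the phases of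
`M(θ, β)` (`edgePhase_right_end`, `edgePhase_up_end`, `vertexConditions_phaseMul_iff`).

One edge. For `z` outside the Dirichlet spectrum, `-φ'' + Vφ - zφ = h` is uniquely solvable with
prescribed end values: `φ = R h + φ(0) v + φ(l) w`. By Green's formula the derivatives at the ends
are bounded functionals of `h` plus the Krein matrix applied to the end values, as in `(φ'(0),
-φ'(l))` (`kreinMatrix_eq`, `exists_edgeResolvent`).

Lattice. Continuity at the nodes expresses all end values through one sequence `g`. Inserting the
derivatives into the flux condition gives `N g + τ h = 0`, where `N = (1 + β²)(s₁₁ + s₂₂) - α + s₁₂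
M(θ, β)` and `τ h` is the flux of the Dirichlet solutions (`EdgeResolvent.flux_eq`). So `(L - z) f =
h` means, up to the gauge, `f = R h + γ g` with `N g + τ h = 0`. Since `γ` is injective and `τ`
surjective, this is solvable by a bounded inverse exactly when `N` is invertible
(`mem_resolventSet_iff_isUnit`). The argument uses no self-adjointness.

The one analytic point on the lattice is that the node values of an `L²` solution lie in `ℓ²`. It is
settled by the bounded functional `κ`, which recovers `φ(0)` from the homogeneous part of the
solution. -/

theorem absolutelyContinuousOnInterval_congr {X : Type*} [PseudoMetricSpace X] {f g : ℝ → X} {a b : ℝ}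
    (hf : AbsolutelyContinuousOnInterval f a b) (h : EqOn g f (uIcc a b)) :
    AbsolutelyContinuousOnInterval g a b := by
  rw [absolutelyContinuousOnInterval_iff] at hf ⊢
  intro ε hε
  obtain ⟨δ, hδ, H⟩ := hf ε hε
  refine ⟨δ, hδ, fun I hI hI' => ?_⟩
  convert H I hI hI' using 1
  refine Finset.sum_congr rfl fun i hi => ?_
  rw [h (hI.1 i hi).1, h (hI.1 i hi).2]

/-- The increments are dominated by those of the primitive of `‖v‖`, which reduces the vector-valued
case to the real one. -/
theorem absolutelyContinuousOnInterval_primitive [CompleteSpace E] {v : ℝ → E}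
    (hv : IntervalIntegrable v volume 0 l) :
    AbsolutelyContinuousOnInterval (fun t => ∫ s in (0 : ℝ)..t, v s) 0 l := by
  have h1 := hv.norm.absolutelyContinuousOnInterval_intervalIntegral (c := 0) (by simp)
  rw [absolutelyContinuousOnInterval_iff] at h1 ⊢
  intro ε hε
  obtain ⟨δ, hδ, H⟩ := h1 ε hε
  refine ⟨δ, hδ, fun I hI hI' => lt_of_le_of_lt (Finset.sum_le_sum fun i hi => ?_) (H I hI hI')⟩
  have hx := (hI.1 i hi).1
  have hy := (hI.1 i hi).2
  have hsub : ∀ x ∈ uIcc 0 l, IntervalIntegrable v volume 0 x := fun x hx =>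
    hv.mono_set (uIcc_subset_uIcc left_mem_uIcc hx)
  rw [dist_eq_norm, dist_eq_norm, intervalIntegral.integral_interval_sub_left (hsub _ hx) (hsub _ hy),
    intervalIntegral.integral_interval_sub_left (hsub _ hx).norm (hsub _ hy).norm, Real.norm_eq_abs]
  exact intervalIntegral.norm_integral_le_abs_integral_norm

theorem ae_edge_iff (p : ℝ → Prop) :
    (∀ᵐ t ∂(edgeMeasure l), p t) ↔ ∀ᵐ t, t ∈ Icc 0 l → p t :=
  ae_restrict_iff' measurableSet_Icc

theorem ae_mem_Ioo (l : ℝ) : ∀ᵐ t ∂(edgeMeasure l), t ∈ Ioo 0 l := by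
  have h : edgeMeasure l = volume.restrict (Ioo 0 l) :=
    (Measure.restrict_congr_set Ioo_ae_eq_Icc).symm
  rw [h]
  exact ae_restrict_mem measurableSet_Ioo

theorem memLp_edge_intervalIntegrable {F : Type*} [NormedAddCommGroup F] (hl : 0 ≤ l) {v : ℝ → F} (hv : MemLp v 2 (edgeMeasure l)) :
    IntervalIntegrable v volume 0 l := by
  rw [intervalIntegrable_iff_integrableOn_Icc_of_le hl]
  exact hv.integrable (by norm_num)

theorem memLp_edge_of_continuousOn {F : Type*} [NormedAddCommGroup F] {v : ℝ → F}
    (hv : ContinuousOn v (Icc 0 l)) : MemLp v 2 (edgeMeasure l) := by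
  obtain ⟨C, hC⟩ := isCompact_Icc.exists_bound_of_continuousOn hv
  refine MemLp.of_bound (hv.aestronglyMeasurable measurableSet_Icc) C ?_
  filter_upwards [ae_mem_edge l] with t ht using hC t ht

theorem MemH1.absolutelyContinuous [CompleteSpace E] (hl : 0 ≤ l) {u : ℝ → E} (hu : MemH1 l u) :
    AbsolutelyContinuousOnInterval u 0 l := by
  obtain ⟨v, hv, h⟩ := hu
  have h1 := absolutelyContinuousOnInterval_primitive (memLp_edge_intervalIntegrable hl hv)
  have h2 : AbsolutelyContinuousOnInterval (fun _ : ℝ => u 0) 0 l :=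
    contDiff_const.contDiffOn.absolutelyContinuousOnInterval
  refine absolutelyContinuousOnInterval_congr (h2.add h1) fun t ht => ?_
  rw [uIcc_of_le hl] at ht
  exact h t ht

theorem MemH1.continuousOn [CompleteSpace E] (hl : 0 ≤ l) {u : ℝ → E} (hu : MemH1 l u) :
    ContinuousOn u (Icc 0 l) := by
  simpa [uIcc_of_le hl] using (hu.absolutelyContinuous hl).continuousOn

/-- An absolutely continuous function is the primitive of its almost everywhere derivative. -/
theorem eq_add_integral_of_ae_hasDerivAt [CompleteSpace E] (hl : 0 ≤ l) {u v : ℝ → E}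
    (hu : AbsolutelyContinuousOnInterval u 0 l) (hv : IntervalIntegrable v volume 0 l)
    (h : ∀ᵐ t ∂(edgeMeasure l), HasDerivAt u (v t) t) {t : ℝ} (ht : t ∈ Icc 0 l) :
    u t = u 0 + ∫ s in (0 : ℝ)..t, v s := by
  have h1 := absolutelyContinuousOnInterval_primitive hv
  obtain ⟨C, hC⟩ := (hu.sub h1).const_of_ae_hasDerivAt_zero (by
    rw [ae_edge_iff] at h
    filter_upwards [h, hv.ae_hasDerivAt_integral] with t h2 h3 ht
    rw [uIcc_of_le hl] at ht h3
    have h4 := (h2 ht).sub (h3 ht 0 ⟨le_rfl, hl⟩)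
    rwa [sub_self] at h4)
  rw [uIcc_of_le hl] at hC
  have h5 := hC t ht
  have h6 := hC 0 ⟨le_rfl, hl⟩
  simp only [Pi.sub_apply, intervalIntegral.integral_same, sub_zero] at h5 h6
  rw [h6, ← h5]
  abel

theorem memH1_of_ae_hasDerivAt [CompleteSpace E] (hl : 0 ≤ l) {u v : ℝ → E}
    (hu : AbsolutelyContinuousOnInterval u 0 l) (hv : MemLp v 2 (edgeMeasure l))
    (h : ∀ᵐ t ∂(edgeMeasure l), HasDerivAt u (v t) t) : MemH1 l u :=
  ⟨v, hv, fun _ ht =>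
    eq_add_integral_of_ae_hasDerivAt hl hu (memLp_edge_intervalIntegrable hl hv) h ht⟩

theorem edgeDeriv_eq_of_hasDerivWithinAt (hl : 0 < l) {u : ℝ → E} {u' : E} {t : ℝ}
    (ht : t ∈ Icc 0 l) (h : HasDerivWithinAt u u' (Icc 0 l) t) : edgeDeriv l u t = u' :=
  h.derivWithin (uniqueDiffOn_Icc hl t ht)

theorem MemH1.ae_hasDerivAt [CompleteSpace E] {u : ℝ → E} (hu : MemH1 l u) :
    ∀ᵐ t ∂(edgeMeasure l), HasDerivAt u (edgeDeriv l u t) t := by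
  filter_upwards [hu.ae_differentiable, ae_mem_Ioo l] with t h1 h2
  exact h1.hasDerivWithinAt.hasDerivAt (Icc_mem_nhds h2.1 h2.2)

/-- `MemH1` only provides some `L²` density. By Lebesgue differentiation it agrees almost everywhere
with the pointwise derivative, which may therefore serve as the density from here on. -/
theorem MemH1.memLp_edgeDeriv [CompleteSpace E] {u : ℝ → E} (hu : MemH1 l u) :
    MemLp (edgeDeriv l u) 2 (edgeMeasure l) := by
  obtain ⟨v, hv, h⟩ := id hu
  rcases lt_or_ge l 0 with hl | hl
  · simp [edgeMeasure, Icc_eq_empty (not_le.mpr hl)]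
  refine hv.ae_eq ?_
  have hint := memLp_edge_intervalIntegrable hl hv
  have h3 := hint.ae_hasDerivAt_integral
  rw [uIcc_of_le hl] at h3
  filter_upwards [hu.ae_hasDerivAt, (ae_edge_iff _).2 h3, ae_mem_Ioo l] with t h1 h2 ht
  have h4 := (h2 0 ⟨le_rfl, hl⟩).const_add (u 0)
  refine HasDerivAt.unique (h4.congr_of_eventuallyEq ?_) h1
  filter_upwards [Icc_mem_nhds ht.1 ht.2] with s hs using h s hs

theorem MemH1.eq_add_integral [CompleteSpace E] (hl : 0 ≤ l) {u : ℝ → E} (hu : MemH1 l u) {t : ℝ}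
    (ht : t ∈ Icc 0 l) : u t = u 0 + ∫ s in (0 : ℝ)..t, edgeDeriv l u s :=
  eq_add_integral_of_ae_hasDerivAt hl (hu.absolutelyContinuous hl)
    (memLp_edge_intervalIntegrable hl hu.memLp_edgeDeriv) hu.ae_hasDerivAt ht

theorem memH1_of_hasDerivWithinAt [CompleteSpace E]
    (hl : 0 < l) {u u' : ℝ → E}
    (h : ∀ t ∈ Icc 0 l, HasDerivWithinAt u (u' t) (Icc 0 l) t) (hc : ContinuousOn u' (Icc 0 l)) :
    MemH1 l u := by
  have hC : ContDiffOn ℝ 1 u (Icc 0 l) := by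
    rw [show (1 : WithTop ℕ∞) = 0 + 1 from rfl, contDiffOn_succ_iff_derivWithin (uniqueDiffOn_Icc hl)]
    refine ⟨fun t ht => (h t ht).differentiableWithinAt, by simp, ?_⟩
    rw [contDiffOn_zero]
    exact hc.congr fun t ht => edgeDeriv_eq_of_hasDerivWithinAt hl ht (h t ht)
  refine memH1_of_ae_hasDerivAt hl.le (v := u') ?_ (memLp_edge_of_continuousOn hc) ?_
  · refine ContDiffOn.absolutelyContinuousOnInterval ?_
    rwa [uIcc_of_le hl.le]
  · filter_upwards [ae_mem_Ioo l] with t ht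
    exact (h t (Ioo_subset_Icc_self ht)).hasDerivAt (Icc_mem_nhds ht.1 ht.2)

end Calculus

/-! ### Products, `H²` functions and Green's formula -/

theorem memLp_continuousOn_mul {l : ℝ} {f g : ℝ → ℂ} (hf : ContinuousOn f (Icc 0 l))
    (hg : MemLp g 2 (edgeMeasure l)) : MemLp (fun t => f t * g t) 2 (edgeMeasure l) := by
  obtain ⟨C, hC⟩ := isCompact_Icc.exists_bound_of_continuousOn hf
  refine MemLp.of_le_mul (c := C) hg
    ((hf.aestronglyMeasurable measurableSet_Icc).mul hg.1) ?_
  filter_upwards [ae_mem_edge l] with t ht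
  rw [norm_mul]
  exact mul_le_mul_of_nonneg_right (hC t ht) (norm_nonneg _)

theorem MemH1.mul {l : ℝ} (hl : 0 ≤ l) {f g : ℝ → ℂ} (hf : MemH1 l f) (hg : MemH1 l g) :
    MemH1 l (fun t => f t * g t) := by
  refine memH1_of_ae_hasDerivAt hl (v := fun t => g t * edgeDeriv l f t + f t * edgeDeriv l g t)
    ((hf.absolutelyContinuous hl).smul (hg.absolutelyContinuous hl))
    ((memLp_continuousOn_mul (hg.continuousOn hl) hf.memLp_edgeDeriv).add
      (memLp_continuousOn_mul (hf.continuousOn hl) hg.memLp_edgeDeriv)) ?_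
  filter_upwards [hf.ae_hasDerivAt, hg.ae_hasDerivAt] with t h1 h2
  exact (h1.mul h2).congr_deriv (by ring)

theorem MemH1.ofReal {l : ℝ} {f : ℝ → ℝ} (hf : MemH1 l f) : MemH1 l (fun t => (f t : ℂ)) := by
  obtain ⟨v, hv, h⟩ := hf
  refine ⟨fun t => (v t : ℂ), hv.ofReal, fun t ht => ?_⟩
  simp only [h t ht, intervalIntegral.integral_ofReal]
  push_cast
  rfl

theorem MemH2.hasDerivWithinAt {l : ℝ} {u : ℝ → ℂ} (hu : MemH2 l u) {t : ℝ} (ht : t ∈ Icc 0 l) :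
    HasDerivWithinAt u (edgeDeriv l u t) (Icc 0 l) t :=
  (hu.1 t ht).hasDerivWithinAt

theorem MemH2.memH1 {l : ℝ} (hl : 0 < l) {u : ℝ → ℂ} (hu : MemH2 l u) : MemH1 l u :=
  memH1_of_hasDerivWithinAt hl (fun _ ht => hu.hasDerivWithinAt ht) (hu.2.continuousOn hl.le)

theorem memH2_of_hasDerivWithinAt {l : ℝ} (hl : 0 < l) {u u' : ℝ → ℂ}
    (h : ∀ t ∈ Icc 0 l, HasDerivWithinAt u (u' t) (Icc 0 l) t) (h' : MemH1 l u') : MemH2 l u :=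
  ⟨fun t ht => (h t ht).differentiableWithinAt,
    h'.congr fun t ht => edgeDeriv_eq_of_hasDerivWithinAt hl ht (h t ht)⟩

theorem MemH2.memLp_schrodinger {l : ℝ} {V : ℝ → ℝ} (hV : MemLp V 2 (edgeMeasure l))
    {u : ℝ → ℂ} (hu : MemH2 l u) : MemLp (schrodinger l V u) 2 (edgeMeasure l) := by
  have h1 := memLp_continuousOn_mul hu.1.continuousOn (hV.ofReal (K := ℂ))
  refine (hu.2.memLp_edgeDeriv.neg.add h1).ae_eq (Filter.Eventually.of_forall fun t => ?_)
  simp [schrodinger, mul_comm]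

/-- Green's formula on a segment. -/
theorem integral_schrodinger_mul_sub {l : ℝ} (hl : 0 < l) {V : ℝ → ℝ} {u w : ℝ → ℂ}
    (hu : MemH2 l u) (hw : MemH2 l w) :
    ∫ t in (0 : ℝ)..l, (schrodinger l V u t * w t - u t * schrodinger l V w t)
      = (u l * edgeDeriv l w l - edgeDeriv l u l * w l)
        - (u 0 * edgeDeriv l w 0 - edgeDeriv l u 0 * w 0) := by
  have hu1 := hu.memH1 hl
  have hw1 := hw.memH1 hl
  have hu' := hu.2
  have hw' := hw.2
  have hac : AbsolutelyContinuousOnInterval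
      (fun t => u t * edgeDeriv l w t - edgeDeriv l u t * w t) 0 l :=
    ((hu1.absolutelyContinuous hl.le).smul (hw'.absolutelyContinuous hl.le)).sub
      ((hu'.absolutelyContinuous hl.le).smul (hw1.absolutelyContinuous hl.le))
  have hint : IntervalIntegrable (fun t => edgeDeriv l (edgeDeriv l w) t * u t
      - edgeDeriv l (edgeDeriv l u) t * w t) volume 0 l := by
    refine memLp_edge_intervalIntegrable hl.le
      (((memLp_continuousOn_mul (hu1.continuousOn hl.le) hw'.memLp_edgeDeriv).sub
      (memLp_continuousOn_mul (hw1.continuousOn hl.le) hu'.memLp_edgeDeriv)).ae_eq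
        (Filter.Eventually.of_forall fun t => ?_))
    simp [mul_comm]
  have h := eq_add_integral_of_ae_hasDerivAt hl.le hac hint (by
    filter_upwards [hu1.ae_hasDerivAt, hw1.ae_hasDerivAt, hu'.ae_hasDerivAt, hw'.ae_hasDerivAt]
      with t h1 h2 h3 h4
    exact ((h1.mul h4).sub (h3.mul h2)).congr_deriv (by ring)) (right_mem_Icc.2 hl.le)
  rw [h, add_sub_cancel_left]
  refine intervalIntegral.integral_congr fun t _ => ?_
  simp only [schrodinger]
  ring

/-! ### Removing the magnetic potential of an edge -/

section Gauge

variable {l : ℝ} {A P : ℝ → ℝ} {φ : ℝ → ℂ}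

/-- Multiplication of a function by the phase factor `exp (i P)`. -/
def phaseMul (P : ℝ → ℝ) (φ : ℝ → ℂ) : ℝ → ℂ := fun t => Complex.exp (Complex.I * P t) * φ t

theorem hasDerivAt_phase {t : ℝ} (hP : HasDerivAt P (A t) t) :
    HasDerivAt (fun s => Complex.exp (Complex.I * P s))
      (Complex.exp (Complex.I * P t) * (Complex.I * A t)) t :=
  (hP.ofReal_comp.const_mul Complex.I).cexp

theorem hasDerivWithinAt_phaseMul {s : Set ℝ} {t : ℝ} (hP : HasDerivAt P (A t) t) {φ' : ℂ}
    (hφ : HasDerivWithinAt φ φ' s t) :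
    HasDerivWithinAt (phaseMul P φ)
      (Complex.exp (Complex.I * P t) * (φ' + Complex.I * A t * φ t)) s t := by
  exact ((hasDerivAt_phase hP).hasDerivWithinAt.mul hφ).congr_deriv (by ring)

theorem phaseMul_neg (P : ℝ → ℝ) (φ : ℝ → ℂ) : phaseMul P (phaseMul (-P) φ) = φ := by
  funext t
  simp only [phaseMul, Pi.neg_apply, ← mul_assoc, ← Complex.exp_add]
  simp

theorem edgeDeriv_phaseMul (hl : 0 < l) (hP : ∀ t, HasDerivAt P (A t) t)
    (hφ : MemH2 l φ) {t : ℝ} (ht : t ∈ Icc 0 l) : edgeDeriv l (phaseMul P φ) t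
      = Complex.exp (Complex.I * P t) * (edgeDeriv l φ t + Complex.I * A t * φ t) :=
  edgeDeriv_eq_of_hasDerivWithinAt hl ht (hasDerivWithinAt_phaseMul (hP t) (hφ.hasDerivWithinAt ht))

theorem MemH2.phaseMul (hl : 0 < l) (hP : ∀ t, HasDerivAt P (A t) t) (hA : MemH1 l A)
    (hφ : MemH2 l φ) : MemH2 l (phaseMul P φ) := by
  refine memH2_of_hasDerivWithinAt hl
    (fun t ht => hasDerivWithinAt_phaseMul (hP t) (hφ.hasDerivWithinAt ht)) ?_
  have hA' := hA.ofReal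
  have hIA : MemH1 l (fun t => Complex.I * (A t : ℂ)) := hA'.smul Complex.I
  have he : MemH1 l (fun t => Complex.exp (Complex.I * P t)) := by
    have hPc : ContinuousOn (fun t => Complex.exp (Complex.I * P t)) (Icc 0 l) := fun t _ =>
      (hasDerivAt_phase (hP t)).continuousAt.continuousWithinAt
    exact memH1_of_hasDerivWithinAt hl (fun t _ => (hasDerivAt_phase (hP t)).hasDerivWithinAt)
      (hPc.mul (hIA.continuousOn hl.le))
  exact he.mul hl.le (hφ.2.add (hIA.mul hl.le (hφ.memH1 hl)))

/-- Since `P' = A`, the term `iA` produced by differentiating `exp (i P)` cancels the one in the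
magnetic derivative. -/
theorem covDeriv_phaseMul (hl : 0 < l) (hP : ∀ t, HasDerivAt P (A t) t)
    (hφ : MemH2 l φ) {t : ℝ} (ht : t ∈ Icc 0 l) :
    covDeriv l A (phaseMul P φ) t = Complex.exp (Complex.I * P t) * edgeDeriv l φ t := by
  rw [covDeriv, edgeDeriv_phaseMul hl hP hφ ht, QuantumGraph.phaseMul]
  ring

/-- The phase intertwines `-i d/dt - A` with `-i d/dt`, applied twice. The identity holds only
almost everywhere, because `φ'` need only be differentiable almost everywhere. -/
theorem magneticSchrodinger_phaseMul (hl : 0 < l) (hP : ∀ t, HasDerivAt P (A t) t)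
    {V : ℝ → ℝ} (hφ : MemH2 l φ) : magneticSchrodinger l A V (phaseMul P φ)
      =ᵐ[edgeMeasure l] phaseMul P (schrodinger l V φ) := by
  have h1 : EqOn (momentum l A (phaseMul P φ))
      (phaseMul P fun t => -Complex.I * edgeDeriv l φ t) (Icc 0 l) := fun t ht => by
    rw [momentum, edgeDeriv_phaseMul hl hP hφ ht]
    simp only [phaseMul]
    linear_combination (-A t * φ t * Complex.exp (Complex.I * P t)) * Complex.I_mul_I
  filter_upwards [hφ.2.ae_differentiable, ae_mem_edge l] with t h2 ht
  have h3 := edgeDeriv_eq_of_hasDerivWithinAt hl ht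
    (hasDerivWithinAt_phaseMul (hP t) (h2.hasDerivWithinAt.const_mul (-Complex.I)))
  rw [magneticSchrodinger, momentum_congr h1 ht, momentum, h3]
  simp only [phaseMul, schrodinger, edgeDeriv]
  linear_combination (Complex.exp (Complex.I * P t) *
    (derivWithin (derivWithin φ (Icc 0 l)) (Icc 0 l) t
      + Complex.I * A t * derivWithin φ (Icc 0 l) t)) * Complex.I_mul_I

end Gauge

section

/-! ### Resolvents in terms of graphs -/

/-- A two-sided inverse of `T - z` is a bounded map whose graph is that of `T - z` with the
coordinates swapped. In this form operators given by their graphs need no separate treatment of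
domains. -/
theorem mem_resolventSet_iff {H : Type*} [NormedAddCommGroup H] [NormedSpace ℂ H]
    {T : H →ₗ.[ℂ] H} {z : ℂ} :
    z ∈ resolventSet T ↔ ∃ R : H →L[ℂ] H, ∀ h f, R h = f ↔ (f, h + z • f) ∈ T.graph := by
  constructor
  · rintro ⟨R, hR1, hR2⟩
    refine ⟨R, fun h f => ⟨?_, fun hf => ?_⟩⟩
    · rintro rfl
      obtain ⟨hd, hy⟩ := hR2 h
      rw [← sub_eq_iff_eq_add.1 hy]
      exact T.mem_graph ⟨R h, hd⟩
    · obtain ⟨x, hx1, hx2⟩ := T.mem_graph_iff.1 hf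
      have h1 := hR1 x
      simp only at hx1 hx2
      rw [hx2, hx1, add_sub_cancel_right] at h1
      exact h1
  · rintro ⟨R, hR⟩
    refine ⟨R, fun x => ?_, fun y => ?_⟩
    · rw [hR, sub_add_cancel]
      exact T.mem_graph x
    · obtain ⟨x, hx1, hx2⟩ := T.mem_graph_iff.1 ((hR y _).1 rfl)
      simp only at hx1 hx2
      have hd : R y ∈ T.domain := hx1 ▸ x.2
      refine ⟨hd, ?_⟩
      rw [show (⟨R y, hd⟩ : T.domain) = x from Subtype.ext hx1.symm, hx2, add_sub_cancel_right]

/-! ### The inhomogeneous equation on an edge -/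

variable {l : ℝ} {V : ℝ → ℝ} {z : ℂ}

/-- `φ ∈ H²[0, l]` and `-φ'' + V φ - z φ = h`. -/
def IsEdgeSolution (l : ℝ) (V : ℝ → ℝ) (z : ℂ) (h φ : ℝ → ℂ) : Prop :=
  MemH2 l φ ∧ ∀ᵐ t ∂(edgeMeasure l), schrodinger l V φ t = h t + z * φ t

namespace IsEdgeSolution

variable {h k φ ψ : ℝ → ℂ}

theorem add (hφ : IsEdgeSolution l V z h φ) (hψ : IsEdgeSolution l V z k ψ) :
    IsEdgeSolution l V z (h + k) (φ + ψ) := by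
  refine ⟨hφ.1.add hψ.1, ?_⟩
  filter_upwards [schrodinger_add (V := V) hφ.1 hψ.1, hφ.2, hψ.2] with t h1 h2 h3
  rw [h1, Pi.add_apply, h2, h3, Pi.add_apply, Pi.add_apply]
  ring

theorem smul (hφ : IsEdgeSolution l V z h φ) (c : ℂ) :
    IsEdgeSolution l V z (c • h) (c • φ) := by
  refine ⟨hφ.1.smul c, ?_⟩
  filter_upwards [schrodinger_smul (V := V) hφ.1 c, hφ.2] with t h1 h2
  rw [h1, Pi.smul_apply, h2, Pi.smul_apply, Pi.smul_apply, smul_eq_mul, smul_eq_mul, smul_eq_mul]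
  ring

theorem congr (hφ : IsEdgeSolution l V z h φ) (hk : h =ᵐ[edgeMeasure l] k) :
    IsEdgeSolution l V z k φ := by
  refine ⟨hφ.1, ?_⟩
  filter_upwards [hφ.2, hk] with t h1 h2
  rw [h1, h2]

/-- The pairing is bilinear, without conjugation, so the terms with `z` cancel for every complex
`z`. With suitable `ψ` the right side isolates a single boundary value of `φ` or `φ'`. -/
theorem green (hl : 0 < l) (hφ : IsEdgeSolution l V z h φ) (hψ : IsEdgeSolution l V z k ψ) :
    ∫ t, (h t * ψ t - φ t * k t) ∂(edgeMeasure l)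
      = (φ l * edgeDeriv l ψ l - edgeDeriv l φ l * ψ l)
        - (φ 0 * edgeDeriv l ψ 0 - edgeDeriv l φ 0 * ψ 0) := by
  rw [← integral_schrodinger_mul_sub (V := V) hl hφ.1 hψ.1, intervalIntegral.integral_of_le hl.le,
    ← integral_Icc_eq_integral_Ioc]
  refine integral_congr_ae ?_
  filter_upwards [hφ.2, hψ.2] with t h1 h2
  rw [h1, h2]
  ring

end IsEdgeSolution

/-- Serves the two explicit functions used below: the affine interpolation of boundary values and
the cubic bump. -/
theorem memH2_of_contDiff (hl : 0 < l) {u : ℝ → ℂ} (hu : ContDiff ℝ 2 u) :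
    MemH2 l u ∧ ∀ t ∈ Icc 0 l, edgeDeriv l u t = deriv u t := by
  have h1 : ContDiff ℝ 1 (deriv u) := ((contDiff_succ_iff_deriv (n := 1)).1 hu).2.2
  have h2 := (contDiff_one_iff_deriv.1 h1)
  have h3 : ∀ t, HasDerivAt u (deriv u t) t := fun t =>
    (hu.differentiable (by norm_num) t).hasDerivAt
  refine ⟨memH2_of_hasDerivWithinAt hl (fun t _ => (h3 t).hasDerivWithinAt)
    (memH1_of_hasDerivWithinAt hl (fun t _ => (h2.1 t).hasDerivAt.hasDerivWithinAt)
      h2.2.continuousOn), fun t ht => edgeDeriv_eq_of_hasDerivWithinAt hl ht (h3 t).hasDerivWithinAt⟩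

/-- The right-hand side `-u'' + V u - z u` as an element of `L²[0, l]`. -/
theorem exists_isEdgeSolution_of_memH2 (hV : MemLp V 2 (edgeMeasure l)) (z : ℂ) {u : ℝ → ℂ}
    (hu : MemH2 l u) : ∃ h : EdgeSpace l, IsEdgeSolution l V z h u := by
  have h1 : MemLp (fun t => schrodinger l V u t - z * u t) 2 (edgeMeasure l) :=
    (hu.memLp_schrodinger hV).sub ((memLp_edge_of_continuousOn hu.1.continuousOn).const_smul z)
  refine ⟨h1.toLp _, hu, ?_⟩
  filter_upwards [h1.coeFn_toLp] with t ht
  rw [ht]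
  ring

/-! ### Uniqueness for the initial value problem -/

/-- A continuous nonnegative function with `y(t) ≤ ∫₀ᵗ q y` vanishes. -/
theorem eq_zero_of_le_integral_mul {q y : ℝ → ℝ} (hq : IntervalIntegrable q volume 0 l)
    (hq0 : ∀ t, 0 ≤ q t) (hy : ContinuousOn y (Icc 0 l)) (hy0 : ∀ t, 0 ≤ y t)
    (hle : ∀ t ∈ Icc 0 l, y t ≤ ∫ s in (0 : ℝ)..t, q s * y s) : ∀ t ∈ Icc 0 l, y t = 0 := by
  by_contra! hne
  obtain ⟨t₂, ht₂, hyt₂⟩ := hne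
  have hl : 0 ≤ l := ht₂.1.trans ht₂.2
  set Z : Set ℝ := {t | t ∈ Icc 0 l ∧ y t ≠ 0} with hZ
  have hZne : Z.Nonempty := ⟨t₂, ht₂, hyt₂⟩
  have hZbdd : BddBelow Z := ⟨0, fun t ht => ht.1.1⟩
  set t₀ := sInf Z with ht₀
  have h0 : 0 ≤ t₀ := le_csInf hZne fun t ht => ht.1.1
  have h0l : t₀ ≤ l := (csInf_le hZbdd ⟨ht₂, hyt₂⟩).trans ht₂.2
  have hzero : ∀ t ∈ Ico 0 t₀, y t = 0 := fun t ht => by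
    by_contra hyt
    exact notMem_of_lt_csInf ht.2 hZbdd ⟨⟨ht.1, ht.2.le.trans h0l⟩, hyt⟩
  have hF : ContinuousOn (fun t => ∫ s in (0 : ℝ)..t, q s) (Icc 0 l) := by
    have := intervalIntegral.continuousOn_primitive_interval (μ := volume) (f := q) (a := 0) (b := l)
      (by rw [uIcc_of_le hl]; exact (intervalIntegrable_iff_integrableOn_Icc_of_le hl).1 hq)
    rwa [uIcc_of_le hl] at this
  -- Just to the right of `t₀`, the infimum of the points where `y ≠ 0`, the integral of `q` from
  -- `t₀` is below `1/2`. At a maximum point `t'` of `y` on `[t₀, t₁]` this gives `y t' ≤ y t' / 2`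
  -- although `y t' > 0`.
  obtain ⟨δ, hδ, hδ'⟩ := Metric.continuousWithinAt_iff.1 (hF t₀ ⟨h0, h0l⟩) (1 / 2) (by norm_num)
  obtain ⟨t₁, ht₁, ht₁'⟩ := exists_lt_of_csInf_lt hZne (show sInf Z < t₀ + δ by linarith)
  have h01 : t₀ ≤ t₁ := csInf_le hZbdd ht₁
  obtain ⟨t', ht', hmax⟩ := isCompact_Icc.exists_isMaxOn (nonempty_Icc.2 h01)
    (hy.mono (Icc_subset_Icc h0 ht₁.1.2))
  have ht'l : t' ∈ Icc 0 l := ⟨h0.trans ht'.1, ht'.2.trans ht₁.1.2⟩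
  have hpos : 0 < y t' := lt_of_lt_of_le (lt_of_le_of_ne (hy0 t₁) (Ne.symm ht₁.2))
    (hmax (right_mem_Icc.2 h01))
  have hqsub : ∀ a b, a ∈ Icc 0 l → b ∈ Icc 0 l → IntervalIntegrable q volume a b :=
    fun a b ha hb => hq.mono_set (by rw [uIcc_of_le hl]; exact uIcc_subset_Icc ha hb)
  have hqy : ∀ a b, a ∈ Icc 0 l → b ∈ Icc 0 l →
      IntervalIntegrable (fun s => q s * y s) volume a b := fun a b ha hb =>
    (hqsub a b ha hb).mul_continuousOn (hy.mono (uIcc_subset_Icc ha hb))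
  have hm0 : (0 : ℝ) ∈ Icc 0 l := ⟨le_rfl, hl⟩
  have hmt0 : t₀ ∈ Icc 0 l := ⟨h0, h0l⟩
  have h1 : ∫ s in (0 : ℝ)..t₀, q s * y s = 0 := by
    rw [intervalIntegral.integral_of_le h0, integral_Ioc_eq_integral_Ioo]
    refine setIntegral_eq_zero_of_forall_eq_zero fun s hs => ?_
    rw [hzero s ⟨hs.1.le, hs.2⟩, mul_zero]
  have h2 : y t' ≤ ∫ s in t₀..t', q s * y s := by
    have := hle t' ht'l
    rwa [← intervalIntegral.integral_add_adjacent_intervals (hqy 0 t₀ hm0 hmt0)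
      (hqy t₀ t' hmt0 ht'l), h1, zero_add] at this
  have h3 : ∫ s in t₀..t', q s * y s ≤ ∫ s in t₀..t', q s * y t' := by
    refine intervalIntegral.integral_mono_on ht'.1 (hqy _ _ hmt0 ht'l)
      ((hqsub _ _ hmt0 ht'l).mul_const _) fun s hs => ?_
    exact mul_le_mul_of_nonneg_left (hmax ⟨hs.1, hs.2.trans ht'.2⟩) (hq0 s)
  rw [intervalIntegral.integral_mul_const] at h3
  have h4 := hδ' ht'l (by
    rw [Real.dist_eq, abs_of_nonneg (by linarith [ht'.1])]
    linarith [ht'.2])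
  rw [Real.dist_eq, intervalIntegral.integral_interval_sub_left (hqsub 0 t' hm0 ht'l)
    (hqsub 0 t₀ hm0 hmt0)] at h4
  have h5 := (le_abs_self _).trans h4.le
  nlinarith

/-- The initial value problem with zero data has only the zero solution. -/
theorem IsEdgeSolution.eq_zero_of_initial (hl : 0 < l) (hV : MemLp V 2 (edgeMeasure l))
    {φ : ℝ → ℂ} (hφ : IsEdgeSolution l V z 0 φ) (h0 : φ 0 = 0) (h0' : edgeDeriv l φ 0 = 0) :
    EqOn φ 0 (Icc 0 l) := by
  have hφ1 := hφ.1.memH1 hl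
  have hc := hφ1.continuousOn hl.le
  have hc' := hφ.1.2.continuousOn hl.le
  have hVz : IntervalIntegrable (fun t => (V t : ℂ) - z) volume 0 l :=
    memLp_edge_intervalIntegrable hl.le ((hV.ofReal (K := ℂ)).sub
      (memLp_edge_of_continuousOn continuousOn_const))
  have hq : IntervalIntegrable (fun t => 1 + ‖(V t : ℂ) - z‖) volume 0 l :=
    intervalIntegrable_const.add hVz.norm
  -- Grönwall for the first-order system `(φ, φ')' = (φ', (V - z) φ)`: the weight `1 + ‖V - z‖`
  -- dominates the coefficients of both equations.
  have key := eq_zero_of_le_integral_mul (y := fun t => ‖φ t‖ + ‖edgeDeriv l φ t‖) hq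
    (fun t => by positivity) (hc.norm.add hc'.norm) (fun t => by positivity) (fun t ht => by
    have hsub : uIcc 0 t ⊆ Icc 0 l := uIcc_subset_Icc ⟨le_rfl, hl.le⟩ ht
    have hsub' : uIcc 0 t ⊆ uIcc 0 l := by rwa [uIcc_of_le hl.le]
    have e1 := hφ1.eq_add_integral hl.le ht
    have e2 := hφ.1.2.eq_add_integral hl.le ht
    rw [h0, zero_add] at e1
    rw [h0', zero_add] at e2
    have e3 : ∫ s in (0 : ℝ)..t, edgeDeriv l (edgeDeriv l φ) s
        = ∫ s in (0 : ℝ)..t, ((V s : ℂ) - z) * φ s := by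
      refine intervalIntegral.integral_congr_ae ?_
      filter_upwards [(ae_edge_iff _).1 hφ.2] with s hs hs'
      have h1 := hs (hsub (uIoc_subset_uIcc hs'))
      simp only [schrodinger, Pi.zero_apply] at h1
      linear_combination -h1
    rw [e3] at e2
    have b1 : ‖φ t‖ ≤ ∫ s in (0 : ℝ)..t, ‖edgeDeriv l φ s‖ := by
      rw [e1]
      exact intervalIntegral.norm_integral_le_integral_norm ht.1
    have b2 : ‖edgeDeriv l φ t‖ ≤ ∫ s in (0 : ℝ)..t, ‖(V s : ℂ) - z‖ * ‖φ s‖ := by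
      rw [e2]
      refine (intervalIntegral.norm_integral_le_integral_norm ht.1).trans_eq ?_
      simp only [norm_mul]
    have i1 : IntervalIntegrable (fun s => ‖edgeDeriv l φ s‖) volume 0 t :=
      (hc'.mono hsub).norm.intervalIntegrable
    have i2 : IntervalIntegrable (fun s => ‖(V s : ℂ) - z‖ * ‖φ s‖) volume 0 t :=
      (hVz.norm.mono_set hsub').mul_continuousOn (hc.mono hsub).norm
    refine (add_le_add b1 b2).trans ?_
    rw [← intervalIntegral.integral_add i1 i2]
    refine intervalIntegral.integral_mono_on ht.1 (i1.add i2)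
      ((hq.mono_set hsub').mul_continuousOn ((hc.norm.add hc'.norm).mono hsub)) fun s _ => ?_
    nlinarith [norm_nonneg (φ s), norm_nonneg (edgeDeriv l φ s), norm_nonneg ((V s : ℂ) - z),
      mul_nonneg (norm_nonneg ((V s : ℂ) - z)) (norm_nonneg (edgeDeriv l φ s))])
  intro t ht
  have h1 := key t ht
  exact norm_eq_zero.1 (le_antisymm (by linarith [norm_nonneg (edgeDeriv l φ t)]) (norm_nonneg _))

end

section

/-! ### Solution operators on a single edge -/

variable {l : ℝ} {V : ℝ → ℝ} {z : ℂ}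

/-- The bounded functional `h ↦ ∫ h ψ` on `L²[0, l]`. -/
theorem exists_pairing {ψ : ℝ → ℂ} (hψ : MemLp ψ 2 (edgeMeasure l)) :
    ∃ τ : EdgeSpace l →L[ℂ] ℂ, ∀ h : EdgeSpace l, τ h = ∫ t, h t * ψ t ∂(edgeMeasure l) := by
  -- The inner product conjugates its first argument, so the bilinear pairing with `ψ` is the inner
  -- product with its conjugate.
  have h1 : MemLp (fun t => (starRingEnd ℂ) (ψ t)) 2 (edgeMeasure l) := hψ.star
  refine ⟨innerSL ℂ (h1.toLp _), fun h => ?_⟩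
  rw [innerSL_apply_apply, L2.inner_def]
  refine integral_congr_ae ?_
  filter_upwards [h1.coeFn_toLp] with t ht
  rw [ht]
  simp

/-- The solution operators of `-φ'' + V φ - z φ = h`, `φ(0) = a`, `φ(l) = b` on an edge:
the solution is `R h + a v + b w`, and `τ₀ h`, `τ₁ h` are the derivatives of `R h` at the end
points. -/
structure EdgeResolvent (l : ℝ) (V : ℝ → ℝ) (z : ℂ) where
  R : EdgeSpace l →L[ℂ] EdgeSpace l
  v : EdgeSpace l
  w : EdgeSpace l
  τ₀ : EdgeSpace l →L[ℂ] ℂ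
  τ₁ : EdgeSpace l →L[ℂ] ℂ
  /-- a functional that reads off the value at `0` of a solution of the homogeneous equation -/
  κ : EdgeSpace l →L[ℂ] ℂ
  /-- a right-hand side with `(R χ)'(0) = 1` and `(R χ)'(l) = 0` -/
  χ : EdgeSpace l
  exists_solution : ∀ (h : EdgeSpace l) (a b : ℂ), ∃ φ, IsEdgeSolution l V z h φ ∧
    φ 0 = a ∧ φ l = b
  ae_eq : ∀ (h : EdgeSpace l) (φ : ℝ → ℂ), IsEdgeSolution l V z h φ →
    R h + φ 0 • v + φ l • w =ᵐ[edgeMeasure l] φ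
  deriv_zero : ∀ (h : EdgeSpace l) (φ : ℝ → ℂ), IsEdgeSolution l V z h φ →
    edgeDeriv l φ 0 = τ₀ h + kreinMatrix l V z 0 0 * φ 0 + kreinMatrix l V z 0 1 * φ l
  deriv_end : ∀ (h : EdgeSpace l) (φ : ℝ → ℂ), IsEdgeSolution l V z h φ →
    edgeDeriv l φ l = τ₁ h - kreinMatrix l V z 0 1 * φ 0 - kreinMatrix l V z 1 1 * φ l
  κ_v : κ v = 1
  κ_w : κ w = 0
  τ₀_χ : τ₀ χ = 1
  τ₁_χ : τ₁ χ = 0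

/-- Translates `z ∉ spec D` into solvability of the differential equation with zero end values; the
edge analysis below uses the spectral condition only through this form and its consequences. -/
theorem exists_dirichlet_resolvent (hl : 0 < l)
    (hz : z ∉ unboundedSpectrum (dirichletOperator l V)) :
    ∃ R : EdgeSpace l →L[ℂ] EdgeSpace l, ∀ h f, R h = f ↔
      ∃ φ, IsEdgeSolution l V z h φ ∧ φ 0 = 0 ∧ φ l = 0 ∧ f =ᵐ[edgeMeasure l] φ := by
  rw [unboundedSpectrum, notMem_compl_iff, mem_resolventSet_iff] at hz
  obtain ⟨R, hR⟩ := hz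
  refine ⟨R, fun h f => (hR h f).trans ?_⟩
  rw [dirichletOperator_graph hl]
  have key : ∀ φ : ℝ → ℂ, f =ᵐ[edgeMeasure l] φ →
      ((h + z • f : EdgeSpace l) =ᵐ[edgeMeasure l] schrodinger l V φ ↔
        ∀ᵐ t ∂(edgeMeasure l), schrodinger l V φ t = h t + z * φ t) := fun φ hφ => by
    have h1 : (h + z • f : EdgeSpace l) =ᵐ[edgeMeasure l] fun t => h t + z * φ t := by
      filter_upwards [Lp.coeFn_add h (z • f), Lp.coeFn_smul z f, hφ] with t h1 h2 h3
      rw [h1, Pi.add_apply, h2, Pi.smul_apply, h3, smul_eq_mul]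
    exact ⟨fun h2 => h2.symm.trans h1, fun h2 => h1.trans (Filter.EventuallyEq.symm h2)⟩
  constructor
  · rintro ⟨φ, hφ, h0, h1, hf, hg⟩
    exact ⟨φ, ⟨hφ, (key φ hf).1 hg⟩, h0, h1, hf⟩
  · rintro ⟨φ, hφ, h0, h1, hf⟩
    exact ⟨φ, hφ.1, h0, h1, hf, (key φ hf).2 hφ.2⟩

/-! ### The boundary value problem on an edge -/

theorem eqOn_zero_of_dirichlet (hl : 0 < l)
    (hz : z ∉ unboundedSpectrum (dirichletOperator l V)) {φ : ℝ → ℂ}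
    (hφ : IsEdgeSolution l V z 0 φ) (h0 : φ 0 = 0) (h1 : φ l = 0) : EqOn φ 0 (Icc 0 l) := by
  obtain ⟨R, hR⟩ := exists_dirichlet_resolvent hl hz
  have hφL : MemLp φ 2 (edgeMeasure l) := memLp_edge_of_continuousOn hφ.1.1.continuousOn
  have h2 : R 0 = hφL.toLp φ := (hR _ _).2
    ⟨φ, hφ.congr (Lp.coeFn_zero ℂ 2 (edgeMeasure l)).symm, h0, h1, hφL.coeFn_toLp⟩
  rw [map_zero] at h2
  refine eqOn_of_ae_eq hl hφ.1 (memH2_zero l) (hφL.coeFn_toLp.symm.trans ?_)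
  rw [← h2]
  exact Lp.coeFn_zero ℂ 2 (edgeMeasure l)

theorem eqOn_of_boundary_values (hl : 0 < l)
    (hz : z ∉ unboundedSpectrum (dirichletOperator l V)) {h φ ψ : ℝ → ℂ}
    (hφ : IsEdgeSolution l V z h φ) (hψ : IsEdgeSolution l V z h ψ) (h0 : φ 0 = ψ 0)
    (h1 : φ l = ψ l) : EqOn φ ψ (Icc 0 l) := by
  have h2 := hφ.add (hψ.smul (-1))
  rw [show h + (-1 : ℂ) • h = 0 by simp] at h2
  have h3 := eqOn_zero_of_dirichlet hl hz h2 (by simp [h0]) (by simp [h1])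
  intro t ht
  have h4 := h3 ht
  simp only [Pi.add_apply, Pi.smul_apply, smul_eq_mul, Pi.zero_apply] at h4
  linear_combination h4

theorem exists_boundary_value_solution (hl : 0 < l) (hV : MemLp V 2 (edgeMeasure l))
    (hz : z ∉ unboundedSpectrum (dirichletOperator l V)) (h : EdgeSpace l) (a b : ℂ) :
    ∃ φ, IsEdgeSolution l V z h φ ∧ φ 0 = a ∧ φ l = b := by
  obtain ⟨R, hR⟩ := exists_dirichlet_resolvent hl hz
  -- The affine function carries the boundary values; a Dirichlet solution corrects the right-hand
  -- side.
  have hp : MemH2 l (fun t : ℝ => a + (b - a) * ((t / l : ℝ) : ℂ)) := by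
    refine (memH2_of_contDiff hl ?_).1
    exact contDiff_const.add (contDiff_const.mul
      (Complex.ofRealCLM.contDiff.comp (contDiff_id.div_const l)))
  obtain ⟨k, hk⟩ := exists_isEdgeSolution_of_memH2 hV z hp
  obtain ⟨φ, hφ, h0, h1, -⟩ := (hR (h - k) _).1 rfl
  refine ⟨_, (hφ.add hk).congr ?_, ?_, ?_⟩
  · filter_upwards [Lp.coeFn_sub h k] with t ht
    rw [Pi.add_apply, ht, Pi.sub_apply, sub_add_cancel]
  · simp [h0]
  · have hl' : (l : ℂ) ≠ 0 := Complex.ofReal_ne_zero.2 hl.ne'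
    simp [h1, div_self hl']

/-! ### The Krein matrix and the edge resolvent -/

theorem IsSolution.isEdgeSolution {c₀ c₁ : ℂ} {u : ℝ → ℂ} (h : IsSolution l V z c₀ c₁ u) :
    IsEdgeSolution l V z 0 u :=
  ⟨h.1, by filter_upwards [h.2.1] with t ht; rw [ht, Pi.zero_apply, zero_add]⟩

theorem IsEdgeSolution.isSolution {c₀ c₁ : ℂ} {u : ℝ → ℂ} (h : IsEdgeSolution l V z 0 u)
    (h0 : u 0 = c₀) (h1 : edgeDeriv l u 0 = c₁) : IsSolution l V z c₀ c₁ u :=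
  ⟨h.1, by filter_upwards [h.2] with t ht; rw [ht, Pi.zero_apply, zero_add], h0, h1⟩

/-- `solution` falls back to `0` when no solution exists, so one must be exhibited. For `u₁` and
`u₂` it will be a combination of `v` and `w`, which avoids a general existence theorem for the
initial value problem. -/
theorem solution_spec {c₀ c₁ : ℂ} {u : ℝ → ℂ} (h : IsSolution l V z c₀ c₁ u) :
    IsSolution l V z c₀ c₁ (solution l V z c₀ c₁) := by
  have hex : ∃ u, IsSolution l V z c₀ c₁ u := ⟨u, h⟩
  rw [solution, dif_pos hex]
  exact hex.choose_spec

/-- The Krein matrix in terms of the solutions `v`, `w` with boundary values `(1, 0)`, `(0, 1)`. -/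
theorem kreinMatrix_eq (hl : 0 < l) (hV : MemLp V 2 (edgeMeasure l))
    (hz : z ∉ unboundedSpectrum (dirichletOperator l V)) {v w : ℝ → ℂ}
    (hv : IsEdgeSolution l V z 0 v) (hv0 : v 0 = 1) (hvl : v l = 0)
    (hw : IsEdgeSolution l V z 0 w) (hw0 : w 0 = 0) (hwl : w l = 1) :
    kreinMatrix l V z 0 0 = edgeDeriv l v 0 ∧ kreinMatrix l V z 0 1 = edgeDeriv l w 0 ∧
      kreinMatrix l V z 0 1 = -edgeDeriv l v l ∧ kreinMatrix l V z 1 1 = -edgeDeriv l w l := by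
  have m0 : (0 : ℝ) ∈ Icc 0 l := ⟨le_rfl, hl.le⟩
  have ml : l ∈ Icc 0 l := ⟨hl.le, le_rfl⟩
  -- Constancy of the Wronskian of `v` and `w`: `w'(0) = -v'(l)`, the symmetry `s₁₂ = s₂₁`.
  have hgreen := hv.green hl hw
  simp only [Pi.zero_apply, zero_mul, mul_zero, sub_zero, integral_zero, hv0, hvl, hw0, hwl,
    zero_sub, mul_one, one_mul] at hgreen
  -- If `w'(0)` vanished, `w` would have zero initial data, contrary to `w(l) = 1`. Hence `w /
  -- w'(0)` and `v - (v'(0) / w'(0)) w` are solutions with the initial data of `u₁` and `u₂`.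
  have hq : edgeDeriv l w 0 ≠ 0 := fun h => by
    have h1 := hw.eq_zero_of_initial hl hV hw0 h ml
    rw [hwl] at h1
    exact one_ne_zero h1
  have hu1 : IsSolution l V z 0 1 (u₁ l V z) := solution_spec
    (u := (edgeDeriv l w 0)⁻¹ • w) <| by
      have h1 := hw.smul (edgeDeriv l w 0)⁻¹
      rw [smul_zero] at h1
      refine h1.isSolution (by simp [hw0]) ?_
      rw [edgeDeriv_smul hw.1.1 _ m0, Pi.smul_apply, smul_eq_mul, inv_mul_cancel₀ hq]
  have hu2 : IsSolution l V z 1 0 (u₂ l V z) := solution_spec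
    (u := v + (-(edgeDeriv l v 0 / edgeDeriv l w 0)) • w) <| by
      have h1 := hv.add (hw.smul (-(edgeDeriv l v 0 / edgeDeriv l w 0)))
      rw [smul_zero, add_zero] at h1
      refine h1.isSolution (by simp [hw0, hv0]) ?_
      rw [edgeDeriv_add hv.1.1 (hw.1.1.const_smul _) m0, Pi.add_apply,
        edgeDeriv_smul hw.1.1 _ m0, Pi.smul_apply, smul_eq_mul]
      field_simp
      ring
  -- Uniqueness for the boundary value problem expands the chosen `u₁` and `u₂` in `v`, `w`;
  -- comparing derivatives at the ends then gives the matrix entries.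
  have e1 : EqOn (u₁ l V z) (u₁ l V z l • w) (Icc 0 l) := by
    have h1 := hw.smul (u₁ l V z l)
    rw [smul_zero] at h1
    exact eqOn_of_boundary_values hl hz hu1.isEdgeSolution h1 (by simp [hw0, hu1.2.2.1])
      (by simp [hwl])
  have e2 : EqOn (u₂ l V z) (v + u₂ l V z l • w) (Icc 0 l) := by
    have h1 := hv.add (hw.smul (u₂ l V z l))
    rw [smul_zero, add_zero] at h1
    exact eqOn_of_boundary_values hl hz hu2.isEdgeSolution h1 (by simp [hw0, hv0, hu2.2.2.1])
      (by simp [hwl, hvl])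
  have d1 : 1 = u₁ l V z l * edgeDeriv l w 0 := by
    rw [← hu1.2.2.2, edgeDeriv_congr e1 m0, edgeDeriv_smul hw.1.1 _ m0]
    rfl
  have d2 : 0 = edgeDeriv l v 0 + u₂ l V z l * edgeDeriv l w 0 := by
    rw [← hu2.2.2.2, edgeDeriv_congr e2 m0, edgeDeriv_add hv.1.1 (hw.1.1.const_smul _) m0,
      Pi.add_apply, edgeDeriv_smul hw.1.1 _ m0]
    rfl
  have d3 : edgeDeriv l (u₁ l V z) l = u₁ l V z l * edgeDeriv l w l := by
    conv_lhs => rw [edgeDeriv_congr e1 ml, edgeDeriv_smul hw.1.1 _ ml]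
    rfl
  have hne : u₁ l V z l ≠ 0 := fun h => by simp [h] at d1
  have k01 : kreinMatrix l V z 0 1 = edgeDeriv l w 0 := by
    simp only [kreinMatrix, Matrix.smul_apply, Matrix.of_apply, Matrix.cons_val', Matrix.cons_val_zero,
      Matrix.cons_val_one, smul_eq_mul]
    field_simp
    exact d1
  refine ⟨?_, k01, k01.trans (by linear_combination hgreen), ?_⟩
  · simp only [kreinMatrix, Matrix.smul_apply, Matrix.of_apply, Matrix.cons_val', Matrix.cons_val_zero,
      smul_eq_mul]
    field_simp
    linear_combination u₁ l V z l * d2 - u₂ l V z l * d1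
  · simp only [kreinMatrix, Matrix.smul_apply, Matrix.of_apply, Matrix.cons_val',
      Matrix.cons_val_one, Matrix.cons_val_fin_one, smul_eq_mul, d3]
    field_simp

/-- The function `t (1 - t/l)²`: among its four boundary data only the derivative at `0` is nonzero.
Its right-hand side will be the `χ` of the edge resolvent. -/
theorem memH2_bump (hl : 0 < l) : ∃ η : ℝ → ℂ, MemH2 l η ∧ η 0 = 0 ∧ η l = 0 ∧
    edgeDeriv l η 0 = 1 ∧ edgeDeriv l η l = 0 := by
  have hd : ∀ t : ℝ, HasDerivAt (fun t : ℝ => ((t * (1 - t / l) ^ 2 : ℝ) : ℂ))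
      (((1 - t / l) ^ 2 + t * (2 * (1 - t / l) * (-(1 / l))) : ℝ) : ℂ) t := fun t => by
    refine HasDerivAt.ofReal_comp ?_
    have h1 : HasDerivAt (fun t : ℝ => 1 - t / l) (-(1 / l)) t :=
      ((hasDerivAt_id t).div_const l).const_sub 1
    exact ((hasDerivAt_id t).mul (h1.pow 2)).congr_deriv (by simp)
  obtain ⟨h1, h2⟩ := memH2_of_contDiff hl (u := fun t : ℝ => ((t * (1 - t / l) ^ 2 : ℝ) : ℂ))
    (Complex.ofRealCLM.contDiff.comp
      (contDiff_id.mul ((contDiff_const.sub (contDiff_id.div_const l)).pow 2)))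
  refine ⟨_, h1, by simp, by simp [div_self hl.ne'], ?_, ?_⟩
  · rw [h2 0 ⟨le_rfl, hl.le⟩, (hd 0).deriv]
    simp
  · rw [h2 l ⟨hl.le, le_rfl⟩, (hd l).deriv]
    simp [div_self hl.ne']

/-- Every functional is a Green pairing. Pairing `h` with `v` or `w` yields `φ'(0)` or `-φ'(l)` for
the Dirichlet solution `φ`. Pairing a homogeneous solution with the right-hand side `χ` of the bump
yields its value at `0`, and this pairing is `κ`. -/
theorem exists_edgeResolvent (hl : 0 < l) (hV : MemLp V 2 (edgeMeasure l))
    (hz : z ∉ unboundedSpectrum (dirichletOperator l V)) : Nonempty (EdgeResolvent l V z) := by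
  have m0 : (0 : ℝ) ∈ Icc 0 l := ⟨le_rfl, hl.le⟩
  have ml : l ∈ Icc 0 l := ⟨hl.le, le_rfl⟩
  have hzero : (0 : EdgeSpace l) =ᵐ[edgeMeasure l] (0 : ℝ → ℂ) := Lp.coeFn_zero ℂ 2 (edgeMeasure l)
  obtain ⟨R, hR⟩ := exists_dirichlet_resolvent hl hz
  obtain ⟨v, hv, hv0, hvl⟩ := exists_boundary_value_solution hl hV hz 0 1 0
  obtain ⟨w, hw, hw0, hwl⟩ := exists_boundary_value_solution hl hV hz 0 0 1
  replace hv := hv.congr hzero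
  replace hw := hw.congr hzero
  obtain ⟨η, hη, hη0, hηl, hη0', hηl'⟩ := memH2_bump hl
  obtain ⟨χ, hχ⟩ := exists_isEdgeSolution_of_memH2 hV z hη
  obtain ⟨k00, k01, k10, k11⟩ := kreinMatrix_eq hl hV hz hv hv0 hvl hw hw0 hwl
  have hvL : MemLp v 2 (edgeMeasure l) := memLp_edge_of_continuousOn hv.1.1.continuousOn
  have hwL : MemLp w 2 (edgeMeasure l) := memLp_edge_of_continuousOn hw.1.1.continuousOn
  obtain ⟨τ₀, hτ₀⟩ := exists_pairing hvL
  obtain ⟨τ₁, hτ₁⟩ := exists_pairing hwL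
  obtain ⟨κ, hκ⟩ := exists_pairing (Lp.memLp χ)
  have hdir0 : ∀ {h : EdgeSpace l} {φ : ℝ → ℂ}, IsEdgeSolution l V z h φ → φ 0 = 0 → φ l = 0 →
      edgeDeriv l φ 0 = τ₀ h ∧ edgeDeriv l φ l = -τ₁ h := fun {h φ} hφ h0 h1 => by
    have g1 := hφ.green hl hv
    have g2 := hφ.green hl hw
    simp only [Pi.zero_apply, mul_zero, sub_zero, hv0, hvl, h0, h1, zero_mul, zero_sub,
      mul_one, neg_neg] at g1
    simp only [Pi.zero_apply, mul_zero, sub_zero, hw0, hwl, h0, h1, zero_mul, zero_sub,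
      mul_one] at g2
    rw [hτ₀, hτ₁, g1, g2, neg_neg]
    exact ⟨rfl, rfl⟩
  have hdecomp : ∀ {h : EdgeSpace l} {φ : ℝ → ℂ}, IsEdgeSolution l V z h φ →
      ∃ ψ, IsEdgeSolution l V z h ψ ∧ ψ 0 = 0 ∧ ψ l = 0 ∧ R h =ᵐ[edgeMeasure l] ψ ∧
        EqOn φ (ψ + (φ 0 • v + φ l • w)) (Icc 0 l) := fun {h φ} hφ => by
    obtain ⟨ψ, hψ, h0, h1, hRψ⟩ := (hR h _).1 rfl
    refine ⟨ψ, hψ, h0, h1, hRψ, ?_⟩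
    have h2 := hψ.add ((hv.smul (φ 0)).add (hw.smul (φ l)))
    rw [smul_zero, smul_zero, add_zero, add_zero] at h2
    exact eqOn_of_boundary_values hl hz hφ h2 (by simp [h0, hv0, hw0]) (by simp [h1, hvl, hwl])
  have hderiv : ∀ {h : EdgeSpace l} {φ : ℝ → ℂ}, IsEdgeSolution l V z h φ →
      edgeDeriv l φ 0 = τ₀ h + φ 0 * edgeDeriv l v 0 + φ l * edgeDeriv l w 0 ∧
      edgeDeriv l φ l = -τ₁ h + φ 0 * edgeDeriv l v l + φ l * edgeDeriv l w l :=
    fun {h φ} hφ => by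
    obtain ⟨ψ, hψ, h0, h1, -, he⟩ := hdecomp hφ
    have key : ∀ t ∈ Icc 0 l, edgeDeriv l φ t
        = edgeDeriv l ψ t + (φ 0 * edgeDeriv l v t + φ l * edgeDeriv l w t) := fun t ht => by
      rw [edgeDeriv_congr he ht, edgeDeriv_add hψ.1.1
        ((hv.1.1.const_smul _).add (hw.1.1.const_smul _)) ht, Pi.add_apply,
        edgeDeriv_add (hv.1.1.const_smul _) (hw.1.1.const_smul _) ht, Pi.add_apply,
        edgeDeriv_smul hv.1.1 _ ht, edgeDeriv_smul hw.1.1 _ ht]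
      rfl
    obtain ⟨d0, d1⟩ := hdir0 hψ h0 h1
    rw [key 0 m0, key l ml, d0, d1]
    constructor <;> ring
  have hκval : ∀ {φ : ℝ → ℂ} (hφ : IsEdgeSolution l V z 0 φ) (hL : MemLp φ 2 (edgeMeasure l)),
      κ (hL.toLp φ) = φ 0 := fun {φ} hφ hL => by
    have g := hφ.green hl hχ
    simp only [Pi.zero_apply, zero_mul, zero_sub, hη0, hηl, hη0', hηl', mul_zero, mul_one,
      sub_zero] at g
    rw [integral_neg, neg_inj] at g
    rw [hκ, ← g]
    refine integral_congr_ae ?_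
    filter_upwards [hL.coeFn_toLp] with t ht
    rw [ht]
  obtain ⟨c0, c1⟩ := hdir0 hχ hη0 hηl
  exact ⟨{
    R := R
    v := hvL.toLp v
    w := hwL.toLp w
    τ₀ := τ₀
    -- The pairing with `w` gives `-φ'(l)`, whereas this field stands for `φ'(l)`.
    τ₁ := -τ₁
    κ := κ
    χ := χ
    exists_solution := fun h a b => exists_boundary_value_solution hl hV hz h a b
    ae_eq := fun h φ hφ => by
      obtain ⟨ψ, -, -, -, hRψ, he⟩ := hdecomp hφ
      filter_upwards [hRψ, ae_mem_edge l, Lp.coeFn_add (R h + φ 0 • hvL.toLp v) (φ l • hwL.toLp w),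
        Lp.coeFn_add (R h) (φ 0 • hvL.toLp v), Lp.coeFn_smul (φ 0) (hvL.toLp v),
        Lp.coeFn_smul (φ l) (hwL.toLp w), hvL.coeFn_toLp, hwL.coeFn_toLp]
        with t h1 ht h2 h3 h4 h5 h6 h7
      rw [h2, Pi.add_apply, h3, Pi.add_apply, h4, h5, Pi.smul_apply, Pi.smul_apply, h6, h7, h1,
        he ht, add_assoc]
      rfl
    deriv_zero := fun h φ hφ => by
      rw [(hderiv hφ).1, k00, k01]
      ring
    deriv_end := fun h φ hφ => by
      rw [(hderiv hφ).2, k10, k11, neg_apply]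
      ring
    κ_v := (hκval hv hvL).trans hv0
    κ_w := (hκval hw hwL).trans hw0
    τ₀_χ := c0.symm.trans hη0'
    τ₁_χ := by
      rw [neg_apply, ← c1, hηl'] }⟩

end

section

/-! ### Resolvent formula -/

/-- If the inverse of `T - z` is described by a Krein type formula with the operator `N` on the
boundary space, then `z` is in the resolvent set of `T` if and only if `N` is invertible. -/
theorem mem_resolventSet_iff_isUnit {H K : Type*} [NormedAddCommGroup H] [NormedSpace ℂ H]
    [NormedAddCommGroup K] [NormedSpace ℂ K] [CompleteSpace K] {T : H →ₗ.[ℂ] H} {z : ℂ}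
    (R₀ : H →L[ℂ] H) (γ : K →L[ℂ] H) (τ : H →L[ℂ] K) (N : K →L[ℂ] K)
    (hγ : Function.Injective γ) (hτ : Function.Surjective τ)
    (hT : ∀ f h, (f, h + z • f) ∈ T.graph ↔ ∃ g, f = R₀ h + γ g ∧ N g + τ h = 0) :
    z ∈ resolventSet T ↔ IsUnit N := by
  rw [mem_resolventSet_iff]
  constructor
  · rintro ⟨R, hR⟩
    -- Bijectivity suffices by the open mapping theorem. If `N g = 0`, then `γ g` solves the problem
    -- with `h = 0`, so `γ g = R 0 = 0`. For surjectivity, choose `h` with `τ h = -y`; the `g`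
    -- belonging to `R h` satisfies `N g = y`.
    refine ContinuousLinearMap.isUnit_iff_bijective.2 ⟨?_, fun y => ?_⟩
    · rw [injective_iff_map_eq_zero]
      intro g hg
      have h1 : R 0 = γ g := (hR _ _).2 ((hT _ _).2 ⟨g, by simp, by simp [hg]⟩)
      rw [map_zero] at h1
      exact hγ (by rw [← h1, map_zero])
    · obtain ⟨h, hh⟩ := hτ (-y)
      obtain ⟨g, -, hg⟩ := (hT _ _).1 ((hR h _).1 rfl)
      exact ⟨g, by rw [eq_neg_of_add_eq_zero_left hg, hh, neg_neg]⟩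
  · rintro ⟨N, rfl⟩
    have h1 : ∀ x, N.1 ((↑N⁻¹ : K →L[ℂ] K) x) = x := fun x =>
      congrArg (fun S : K →L[ℂ] K => S x) N.mul_inv
    have h2 : ∀ x, (↑N⁻¹ : K →L[ℂ] K) (N.1 x) = x := fun x =>
      congrArg (fun S : K →L[ℂ] K => S x) N.inv_mul
    -- Krein's formula: solve `N g = -τ h` for `g` and insert it into `f = R₀ h + γ g`.
    refine ⟨R₀ - γ ∘L (↑N⁻¹ : K →L[ℂ] K) ∘L τ, fun h f => ?_⟩
    have h3 : (R₀ - γ ∘L (↑N⁻¹ : K →L[ℂ] K) ∘L τ) h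
        = R₀ h + γ (-((↑N⁻¹ : K →L[ℂ] K) (τ h))) := by
      rw [map_neg, ← sub_eq_add_neg]
      rfl
    rw [hT, h3]
    constructor
    · rintro rfl
      exact ⟨_, rfl, by rw [map_neg, h1, neg_add_cancel]⟩
    · rintro ⟨g, rfl, hg⟩
      rw [← h2 g, eq_neg_of_add_eq_zero_left hg, map_neg (↑N⁻¹ : K →L[ℂ] K)]

/-! ### Weighted composition operators on Hilbert sums -/

section WeightedComposition

variable {I J K X Y : Type*} [Fintype K] [NormedAddCommGroup X] [NormedSpace ℂ X]
  [NormedAddCommGroup Y] [NormedSpace ℂ Y]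

/-- The operator `(T x)(j) = B_j (x (σ j))` is bounded if the `B_j` are uniformly bounded and the
fibres of `σ` are uniformly finite. -/
theorem exists_weightedComposition (σ : J → I) (k : J → K)
    (hσ : Function.Injective fun j => (σ j, k j)) (B : J → X →L[ℂ] Y) (C : ℝ)
    (hB : ∀ j, ‖B j‖ ≤ C) :
    ∃ T : lp (fun _ : I => X) 2 →L[ℂ] lp (fun _ : J => Y) 2, ∀ x j, T x j = B j (x (σ j)) := by
  classical
  have hp : 0 < (2 : ENNReal).toReal := by norm_num
  have key : ∀ (x : lp (fun _ : I => X) 2) (s : Finset J),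
      ∑ j ∈ s, ‖B j (x (σ j))‖ ^ (2 : ENNReal).toReal
        ≤ (Real.sqrt (Fintype.card K) * |C| * ‖x‖) ^ (2 : ENNReal).toReal := fun x s => by
    have h1 : ∀ j, ‖B j (x (σ j))‖ ^ (2 : ENNReal).toReal
        ≤ |C| ^ 2 * ‖x (σ j)‖ ^ (2 : ENNReal).toReal := fun j => by
      simp only [ENNReal.toReal_ofNat, Real.rpow_ofNat]
      rw [← mul_pow]
      gcongr
      exact ((B j).le_opNorm _).trans
        (mul_le_mul_of_nonneg_right ((hB j).trans (le_abs_self C)) (norm_nonneg _))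
    refine (Finset.sum_le_sum fun j _ => h1 j).trans ?_
    rw [← Finset.mul_sum]
    -- The label `k` separates the indices `j` with the same `σ j`, so each summand `‖x i‖²` occurs
    -- at most `|K|` times; hence the factor `√|K|` in the norm bound.
    have h2 : ∑ j ∈ s, ‖x (σ j)‖ ^ (2 : ENNReal).toReal
        ≤ ∑ p ∈ (s.image σ) ×ˢ (Finset.univ : Finset K), ‖x p.1‖ ^ (2 : ENNReal).toReal := by
      rw [← Finset.sum_image (f := fun p : I × K => ‖x p.1‖ ^ (2 : ENNReal).toReal)
        (s := s) (g := fun j => (σ j, k j)) (fun a _ b _ h => hσ h)]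
      refine Finset.sum_le_sum_of_subset_of_nonneg ?_ fun p _ _ => by positivity
      intro p hp
      obtain ⟨j, hj, rfl⟩ := Finset.mem_image.1 hp
      exact Finset.mem_product.2 ⟨Finset.mem_image_of_mem σ hj, Finset.mem_univ _⟩
    have h3 : ∑ p ∈ (s.image σ) ×ˢ (Finset.univ : Finset K), ‖x p.1‖ ^ (2 : ENNReal).toReal
        = Fintype.card K * ∑ i ∈ s.image σ, ‖x i‖ ^ (2 : ENNReal).toReal := by
      rw [Finset.sum_product, Finset.mul_sum]
      simp
    have h4 := lp.sum_rpow_le_norm_rpow hp x (s.image σ)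
    rw [h3] at h2
    calc |C| ^ 2 * ∑ j ∈ s, ‖x (σ j)‖ ^ (2 : ENNReal).toReal
        ≤ |C| ^ 2 * (Fintype.card K * ‖x‖ ^ (2 : ENNReal).toReal) := by
          refine mul_le_mul_of_nonneg_left (h2.trans ?_) (by positivity)
          exact mul_le_mul_of_nonneg_left h4 (by positivity)
      _ = _ := by
          simp only [ENNReal.toReal_ofNat, Real.rpow_ofNat]
          rw [mul_pow, mul_pow, Real.sq_sqrt (by positivity)]
          ring
  refine ⟨LinearMap.mkContinuous
    { toFun := fun x => ⟨fun j => B j (x (σ j)), memℓp_gen' (key x)⟩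
      map_add' := fun x y => lp.ext (funext fun j => map_add (B j) (x (σ j)) (y (σ j)))
      map_smul' := fun c x => lp.ext (funext fun j => map_smul (B j) c (x (σ j))) }
    (Real.sqrt (Fintype.card K) * |C|)
    (fun x => lp.norm_le_of_forall_sum_le hp (by positivity) (key x)), fun x j => rfl⟩

end WeightedComposition

/-! ### Multiplication by a phase factor on `L²[0, l]` -/

section Phase

variable {l : ℝ} {P : ℝ → ℝ}

theorem norm_phaseMul (P : ℝ → ℝ) (φ : ℝ → ℂ) (t : ℝ) : ‖phaseMul P φ t‖ = ‖φ t‖ := by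
  rw [phaseMul, norm_mul, mul_comm Complex.I, Complex.norm_exp_ofReal_mul_I, one_mul]

theorem exists_phaseCLM (l : ℝ) (hP : Continuous P) :
    ∃ U : EdgeSpace l →L[ℂ] EdgeSpace l, ‖U‖ ≤ 1 ∧
      ∀ f : EdgeSpace l, U f =ᵐ[edgeMeasure l] phaseMul P f := by
  have hm : ∀ f : EdgeSpace l, MemLp (phaseMul P f) 2 (edgeMeasure l) := fun f => by
    refine MemLp.of_le (Lp.memLp f) ?_ (Filter.Eventually.of_forall fun t =>
      (norm_phaseMul P f t).le)
    have : Continuous fun t => Complex.exp (Complex.I * P t) := by fun_prop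
    exact this.aestronglyMeasurable.mul (Lp.aestronglyMeasurable f)
  refine ⟨LinearMap.mkContinuous
    { toFun := fun f => (hm f).toLp _
      map_add' := fun f g => Lp.ext ?_
      map_smul' := fun c f => Lp.ext ?_ } 1 fun f => ?_, ?_, fun f => (hm f).coeFn_toLp⟩
  · filter_upwards [(hm (f + g)).coeFn_toLp, Lp.coeFn_add ((hm f).toLp _) ((hm g).toLp _),
      (hm f).coeFn_toLp, (hm g).coeFn_toLp, Lp.coeFn_add f g] with t h1 h2 h3 h4 h5
    rw [h1, h2, Pi.add_apply, h3, h4, phaseMul, h5]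
    exact mul_add _ _ _
  · filter_upwards [(hm (c • f)).coeFn_toLp, Lp.coeFn_smul c ((hm f).toLp _),
      (hm f).coeFn_toLp, Lp.coeFn_smul c f] with t h1 h2 h3 h4
    simp only [RingHom.id_apply]
    rw [h1, h2, Pi.smul_apply, h3, phaseMul, h4]
    exact mul_left_comm _ _ _
  · rw [one_mul]
    refine Lp.norm_le_norm_of_ae_le ?_
    filter_upwards [(hm f).coeFn_toLp] with t ht
    exact ((congrArg norm ht).trans (norm_phaseMul P f t)).le
  · exact LinearMap.mkContinuous_norm_le _ zero_le_one _

/-- The magnetic equation on an edge is the equation without magnetic potential for the function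
with the phase factor removed. -/
theorem magnetic_pair_iff (hl : 0 < l) {A V : ℝ → ℝ} {z : ℂ} (hP : ∀ t, HasDerivAt P (A t) t)
    {φ : ℝ → ℂ} (hφ : MemH2 l φ) {f h : EdgeSpace l} (f' h' : EdgeSpace l)
    (hf : f =ᵐ[edgeMeasure l] phaseMul P f') (hh : h =ᵐ[edgeMeasure l] phaseMul P h') :
    ((f =ᵐ[edgeMeasure l] phaseMul P φ) ∧ ((h + z • f : EdgeSpace l) =ᵐ[edgeMeasure l]
      magneticSchrodinger l A V (phaseMul P φ))) ↔
    ((f' =ᵐ[edgeMeasure l] φ) ∧ IsEdgeSolution l V z h' φ) := by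
  have e0 : ∀ t, Complex.exp (Complex.I * P t) ≠ 0 := fun t => Complex.exp_ne_zero _
  have h1 : (f =ᵐ[edgeMeasure l] phaseMul P φ) ↔ (f' =ᵐ[edgeMeasure l] φ) := by
    constructor
    · intro h
      filter_upwards [h, hf] with t h1 h2
      exact mul_left_cancel₀ (e0 t) (h2.symm.trans h1)
    · intro h
      filter_upwards [h, hf] with t h1 h2
      rw [h2, phaseMul, h1, phaseMul]
  rw [h1]
  refine and_congr_right fun hfφ => ?_
  have h2 : (h + z • f : EdgeSpace l) =ᵐ[edgeMeasure l]
      phaseMul P (fun t => h' t + z * φ t) := by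
    filter_upwards [Lp.coeFn_add h (z • f), Lp.coeFn_smul z f, hh, h1.2 hfφ] with t a1 a2 a3 a4
    rw [a1, Pi.add_apply, a2, Pi.smul_apply, a3, a4, smul_eq_mul]
    simp only [phaseMul]
    ring
  have h3 := magneticSchrodinger_phaseMul (V := V) hl hP hφ
  constructor
  · intro h
    refine ⟨hφ, ?_⟩
    filter_upwards [h, h2, h3] with t a1 a2 a3
    exact mul_left_cancel₀ (e0 t) (a3.symm.trans (a1.symm.trans a2))
  · rintro ⟨-, h⟩
    filter_upwards [h, h2, h3] with t a1 a2 a3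
    rw [a2, a3, phaseMul, phaseMul, a1]

end Phase

end

/-! ### The gauge transformation of the lattice -/

namespace PeriodicMagneticField

variable {l : ℝ} (F : PeriodicMagneticField l)

theorem continuous_edgePotential (e : Edge) : Continuous (F.edgePotential e) := by
  obtain ⟨m, n, d⟩ := e
  have h1 := F.A₁_continuous
  have h2 := F.A₂_continuous
  cases d
  · rw [show F.edgePotential (m, n, Dir.right) = _ from funext (F.edgePotential_right m n)]
    fun_prop
  · rw [show F.edgePotential (m, n, Dir.up) = _ from funext (F.edgePotential_up m n)]
    fun_prop

/-- The gauge phase at a node. -/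
def nodePhase (m n : ℤ) : ℝ :=
  m * (∫ t in (0 : ℝ)..l, F.A₁ (t, 0)) + n * ∫ t in (0 : ℝ)..l, F.A₂ (0, t)

/-- The gauge phase on an edge. -/
def edgePhase (e : Edge) (t : ℝ) : ℝ :=
  F.nodePhase e.1 e.2.1 + ∫ s in (0 : ℝ)..t, F.edgePotential e s

theorem hasDerivAt_edgePhase (e : Edge) (t : ℝ) :
    HasDerivAt (F.edgePhase e) (F.edgePotential e t) t :=
  ((F.continuous_edgePotential e).integral_hasStrictDerivAt 0 t).hasDerivAt.const_add _

theorem continuous_edgePhase (e : Edge) : Continuous (F.edgePhase e) :=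
  continuous_iff_continuousAt.2 fun t => (F.hasDerivAt_edgePhase e t).continuousAt

theorem edgePhase_zero (e : Edge) : F.edgePhase e 0 = F.nodePhase e.1 e.2.1 := by
  simp [edgePhase]

/-- By periodicity the `A₁` part integrates to the increment of the node phase, while the constant
part gives `-π ξ n l · l = -π n θ`. This defect is what no choice linear in the nodes absorbs here,
and it becomes the horizontal hopping phase. -/
theorem edgePhase_right_end (m n : ℤ) :
    F.edgePhase (m, n, Dir.right) l = F.nodePhase (m + 1) n - Real.pi * n * F.theta := by
  have h1 : Continuous fun t => F.A₁ (t, 0) := by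
    have := F.A₁_continuous
    fun_prop
  simp only [edgePhase, edgePotential_right]
  rw [intervalIntegral.integral_add (by simp) (h1.intervalIntegrable _ _),
    intervalIntegral.integral_const, smul_eq_mul]
  simp only [nodePhase, theta]
  push_cast
  ring

/-- The sign is opposite to the horizontal one because the linear part of the potential is `π ξ
(-x₂, x₁)`. -/
theorem edgePhase_up_end (m n : ℤ) :
    F.edgePhase (m, n, Dir.up) l = F.nodePhase m (n + 1) + Real.pi * m * F.theta := by
  have h1 : Continuous fun t => F.A₂ (0, t) := by
    have := F.A₂_continuous
    fun_prop
  simp only [edgePhase, edgePotential_up]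
  rw [intervalIntegral.integral_add (by simp) (h1.intervalIntegrable _ _),
    intervalIntegral.integral_const, smul_eq_mul]
  simp only [nodePhase, theta]
  push_cast
  ring

end PeriodicMagneticField

/-! ### Vertex conditions after the gauge transformation -/

/-- The final node of an edge. -/
def endNode : Edge → ℤ × ℤ
  | (m, n, Dir.right) => (m + 1, n)
  | (m, n, Dir.up) => (m, n + 1)

/-- The weight of the edges in the vertex conditions. -/
def edgeWeight (β : ℝ) : Edge → ℂ
  | (_, _, Dir.right) => 1
  | (_, _, Dir.up) => β

/-- The gauge phase accumulated along an edge. -/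
def edgeHop (θ : ℝ) : Edge → ℂ
  | (_, n, Dir.right) => Complex.exp (Complex.I * Real.pi * n * θ)
  | (m, _, Dir.up) => Complex.exp (-(Complex.I * Real.pi * m * θ))

/-- The vertex conditions after the gauge transformation, with node values `g`. -/
structure GaugedConditions (θ α β : ℝ) (φ : Edge → ℝ → ℂ) (l : ℝ) (g : ℤ × ℤ → ℂ) : Prop where
  start : ∀ e : Edge, φ e 0 = edgeWeight β e * g (e.1, e.2.1)
  finish : ∀ e : Edge, φ e l = edgeWeight β e * edgeHop θ e * g (endNode e)
  flux : ∀ m n : ℤ,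
    edgeDeriv l (φ (m, n, Dir.right)) 0 + β * edgeDeriv l (φ (m, n, Dir.up)) 0
      - Complex.exp (-(Complex.I * Real.pi * n * θ)) * edgeDeriv l (φ (m - 1, n, Dir.right)) l
      - β * (Complex.exp (Complex.I * Real.pi * m * θ) * edgeDeriv l (φ (m, n - 1, Dir.up)) l)
    = α * g (m, n)

/-- All four phases at a node share the nonzero factor `exp (i · nodePhase)`. It cancels from every
condition and leaves only the defects `exp (-iπnθ)` and `exp (iπmθ)` on the two incoming edges. -/
theorem vertexConditions_phaseMul_iff {l : ℝ} (hl : 0 < l) (F : PeriodicMagneticField l)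
    {α β : ℝ} (hβ : β ≠ 0) {φ : Edge → ℝ → ℂ} (hφ : ∀ e, MemH2 l (φ e)) :
    VertexConditions F α β (fun e => phaseMul (F.edgePhase e) (φ e)) ↔
      GaugedConditions F.theta α β φ l fun p => φ (p.1, p.2, Dir.right) 0 := by
  have m0 : (0 : ℝ) ∈ Icc 0 l := ⟨le_rfl, hl.le⟩
  have ml : l ∈ Icc 0 l := ⟨hl.le, le_rfl⟩
  have hβ' : (β : ℂ) ≠ 0 := Complex.ofReal_ne_zero.2 hβ
  set c : ℤ → ℤ → ℂ := fun m n => Complex.exp (Complex.I * F.nodePhase m n) with hc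
  have c0 : ∀ m n, c m n ≠ 0 := fun m n => Complex.exp_ne_zero _
  have s0 : ∀ e : Edge, Complex.exp (Complex.I * F.edgePhase e 0) = c e.1 e.2.1 := fun e => by
    rw [F.edgePhase_zero]
  have sr : ∀ m n, Complex.exp (Complex.I * F.edgePhase (m - 1, n, Dir.right) l)
      = c m n * Complex.exp (-(Complex.I * Real.pi * n * F.theta)) := fun m n => by
    rw [F.edgePhase_right_end, sub_add_cancel, hc, ← Complex.exp_add]
    congr 1
    push_cast
    ring
  have su : ∀ m n, Complex.exp (Complex.I * F.edgePhase (m, n - 1, Dir.up) l)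
      = c m n * Complex.exp (Complex.I * Real.pi * m * F.theta) := fun m n => by
    rw [F.edgePhase_up_end, sub_add_cancel, hc, ← Complex.exp_add]
    congr 1
    push_cast
    ring
  have hflux : ∀ m n : ℤ,
      (covDeriv l (F.edgePotential (m, n, Dir.right))
          (phaseMul (F.edgePhase (m, n, Dir.right)) (φ (m, n, Dir.right))) 0
        + β * covDeriv l (F.edgePotential (m, n, Dir.up))
          (phaseMul (F.edgePhase (m, n, Dir.up)) (φ (m, n, Dir.up))) 0
        - covDeriv l (F.edgePotential (m - 1, n, Dir.right))
          (phaseMul (F.edgePhase (m - 1, n, Dir.right)) (φ (m - 1, n, Dir.right))) l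
        - β * covDeriv l (F.edgePotential (m, n - 1, Dir.up))
          (phaseMul (F.edgePhase (m, n - 1, Dir.up)) (φ (m, n - 1, Dir.up))) l
      = α * phaseMul (F.edgePhase (m, n, Dir.right)) (φ (m, n, Dir.right)) 0) ↔
      (edgeDeriv l (φ (m, n, Dir.right)) 0 + β * edgeDeriv l (φ (m, n, Dir.up)) 0
      - Complex.exp (-(Complex.I * Real.pi * n * F.theta)) * edgeDeriv l (φ (m - 1, n, Dir.right)) l
      - β * (Complex.exp (Complex.I * Real.pi * m * F.theta) * edgeDeriv l (φ (m, n - 1, Dir.up)) l)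
      = α * φ (m, n, Dir.right) 0) := fun m n => by
    rw [covDeriv_phaseMul hl (F.hasDerivAt_edgePhase _) (hφ _) m0,
      covDeriv_phaseMul hl (F.hasDerivAt_edgePhase _) (hφ _) m0,
      covDeriv_phaseMul hl (F.hasDerivAt_edgePhase _) (hφ _) ml,
      covDeriv_phaseMul hl (F.hasDerivAt_edgePhase _) (hφ _) ml, phaseMul, s0, s0, sr, su]
    constructor
    · intro h
      refine mul_left_cancel₀ (c0 m n) ?_
      linear_combination h
    · intro h
      linear_combination c m n * h
  have er : ∀ n : ℤ, Complex.exp (Complex.I * Real.pi * n * F.theta)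
      * Complex.exp (-(Complex.I * Real.pi * n * F.theta)) = 1 := fun n => by
    rw [← Complex.exp_add, add_neg_cancel, Complex.exp_zero]
  constructor
  · intro h
    refine ⟨fun e => ?_, fun e => ?_, fun m n => (hflux m n).1 (h.flux m n)⟩
    · obtain ⟨m, n, d⟩ := e
      cases d
      · simp [edgeWeight]
      · have h1 := h.up_start m n
        simp only [phaseMul, s0] at h1
        field_simp at h1
        refine mul_left_cancel₀ (c0 m n) ?_
        simp only [edgeWeight]
        linear_combination h1
    · obtain ⟨m, n, d⟩ := e
      cases d
      · have h1 := h.right_end (m + 1) n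
        simp only [phaseMul, s0, sr] at h1
        have h2 := mul_left_cancel₀ (c0 (m + 1) n) ((mul_assoc _ _ _).symm.trans h1)
        rw [add_sub_cancel_right] at h2
        simp only [edgeWeight, edgeHop, endNode]
        rw [← h2]
        linear_combination (-φ (m, n, Dir.right) l) * er n
      · have h1 := h.up_end m (n + 1)
        simp only [phaseMul, s0, su] at h1
        have h2 := mul_left_cancel₀ (c0 m (n + 1)) (Eq.trans (by ring) h1 :
          c m (n + 1) * (1 / (β : ℂ) * (Complex.exp (Complex.I * Real.pi * m * F.theta)
            * φ (m, n + 1 - 1, Dir.up) l)) = _)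
        rw [add_sub_cancel_right] at h2
        simp only [edgeWeight, edgeHop, endNode]
        rw [← h2]
        field_simp
        linear_combination (-φ (m, n, Dir.up) l) * er m
  · intro h
    refine ⟨fun m n => ?_, fun m n => ?_, fun m n => ?_, fun m n => (hflux m n).2 (h.flux m n)⟩
    · have h1 := h.start (m, n, Dir.up)
      simp only [edgeWeight] at h1
      simp only [phaseMul, s0, h1]
      field_simp
    · have h1 := h.finish (m - 1, n, Dir.right)
      simp only [edgeWeight, edgeHop, endNode, sub_add_cancel] at h1
      simp only [phaseMul, s0, sr, h1]
      linear_combination (c m n * φ (m, n, Dir.right) 0) * er n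
    · have h1 := h.finish (m, n - 1, Dir.up)
      simp only [edgeWeight, edgeHop, endNode, sub_add_cancel] at h1
      simp only [phaseMul, s0, su, h1]
      field_simp
      linear_combination (c m n * φ (m, n, Dir.right) 0) * er m

section

/-! ### The boundary operators of the lattice -/

/-- The operator of the vertex conditions on the node values. -/
def vertexOperator (l : ℝ) (V : ℝ → ℝ) (α β θ : ℝ) (z : ℂ) : L2Z2 →L[ℂ] L2Z2 :=
  ((1 + (β : ℂ) ^ 2) * (kreinMatrix l V z 0 0 + kreinMatrix l V z 1 1) - (α : ℂ)) •
    (1 : L2Z2 →L[ℂ] L2Z2) + kreinMatrix l V z 0 1 • discreteMagneticLaplacian θ β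

theorem vertexOperator_apply (l : ℝ) (V : ℝ → ℝ) (α β θ : ℝ) (z : ℂ) (g : L2Z2) (m n : ℤ) :
    vertexOperator l V α β θ z g (m, n)
      = ((1 + (β : ℂ) ^ 2) * (kreinMatrix l V z 0 0 + kreinMatrix l V z 1 1) - (α : ℂ)) * g (m, n)
        + kreinMatrix l V z 0 1 * (Complex.exp (Complex.I * Real.pi * n * θ) * g (m + 1, n)
        + Complex.exp (-(Complex.I * Real.pi * n * θ)) * g (m - 1, n)
        + β ^ 2 * (Complex.exp (-(Complex.I * Real.pi * m * θ)) * g (m, n + 1)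
          + Complex.exp (Complex.I * Real.pi * m * θ) * g (m, n - 1))) := by
  rw [← discreteMagneticLaplacian_apply]
  rfl

variable {l : ℝ} {V : ℝ → ℝ} {z : ℂ}

/-- The direction of an edge as a Boolean. -/
def dirIndex : Edge → Bool
  | (_, _, Dir.right) => false
  | (_, _, Dir.up) => true

/-- A node is the start of two edges, told apart by their direction. This supplies the uniform bound
on the fibres in `exists_weightedComposition`. -/
theorem injective_startNode : Function.Injective fun e : Edge => ((e.1, e.2.1), dirIndex e) := by
  rintro ⟨m, n, _ | _⟩ ⟨m', n', _ | _⟩ h <;> simp_all [dirIndex]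

theorem injective_endNode : Function.Injective fun e : Edge => (endNode e, dirIndex e) := by
  rintro ⟨m, n, _ | _⟩ ⟨m', n', _ | _⟩ h <;> simp_all [dirIndex, endNode]

theorem norm_edgeWeight_le (β : ℝ) (e : Edge) : ‖edgeWeight β e‖ ≤ 1 + |β| := by
  obtain ⟨m, n, _ | _⟩ := e <;> simp [edgeWeight]

theorem norm_edgeHop (θ : ℝ) (e : Edge) : ‖edgeHop θ e‖ = 1 := by
  obtain ⟨m, n, _ | _⟩ := e <;> simp [edgeHop, Complex.norm_exp]

/-- The solution operator of the homogeneous equation with given node values. -/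
theorem EdgeResolvent.exists_nodeExtension (S : EdgeResolvent l V z) (θ β : ℝ) :
    ∃ γ : L2Z2 →L[ℂ] LatticeSpace l, ∀ g e, γ g e = (edgeWeight β e * g (e.1, e.2.1)) • S.v
      + (edgeWeight β e * edgeHop θ e * g (endNode e)) • S.w := by
  obtain ⟨γ₀, h₀⟩ := exists_weightedComposition (fun e : Edge => (e.1, e.2.1)) dirIndex
    injective_startNode (fun e => edgeWeight β e • ContinuousLinearMap.toSpanSingleton ℂ S.v)
    ((1 + |β|) * ‖S.v‖) (fun e => by
      rw [norm_smul, ContinuousLinearMap.norm_toSpanSingleton]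
      exact mul_le_mul_of_nonneg_right (norm_edgeWeight_le β e) (norm_nonneg _))
  obtain ⟨γ₁, h₁⟩ := exists_weightedComposition endNode dirIndex injective_endNode
    (fun e => (edgeWeight β e * edgeHop θ e) • ContinuousLinearMap.toSpanSingleton ℂ S.w)
    ((1 + |β|) * ‖S.w‖) (fun e => by
      rw [norm_smul, ContinuousLinearMap.norm_toSpanSingleton, norm_mul, norm_edgeHop, mul_one]
      exact mul_le_mul_of_nonneg_right (norm_edgeWeight_le β e) (norm_nonneg _))
  refine ⟨γ₀ + γ₁, fun g e => ?_⟩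
  have h : (γ₀ + γ₁) g e = γ₀ g e + γ₁ g e := rfl
  rw [h, h₀, h₁]
  simp only [smul_apply, ContinuousLinearMap.toSpanSingleton_apply, smul_smul]

/-- The flux into the nodes of the Dirichlet solution with given right-hand side. -/
theorem EdgeResolvent.exists_nodeFlux (S : EdgeResolvent l V z) (θ β : ℝ) :
    ∃ τ : LatticeSpace l →L[ℂ] L2Z2, ∀ h m n, τ h (m, n)
      = S.τ₀ (h (m, n, Dir.right)) + β * S.τ₀ (h (m, n, Dir.up))
        - Complex.exp (-(Complex.I * Real.pi * n * θ)) * S.τ₁ (h (m - 1, n, Dir.right))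
        - β * (Complex.exp (Complex.I * Real.pi * m * θ) * S.τ₁ (h (m, n - 1, Dir.up))) := by
  obtain ⟨t₁, h₁⟩ := exists_weightedComposition (K := Unit)
    (fun p : ℤ × ℤ => ((p.1, p.2, Dir.right) : Edge)) (fun _ => ())
    (by rintro ⟨m, n⟩ ⟨m', n'⟩ h; simpa using h) (fun _ => S.τ₀) ‖S.τ₀‖ (fun _ => le_rfl)
  obtain ⟨t₂, h₂⟩ := exists_weightedComposition (K := Unit)
    (fun p : ℤ × ℤ => ((p.1, p.2, Dir.up) : Edge)) (fun _ => ())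
    (by rintro ⟨m, n⟩ ⟨m', n'⟩ h; simpa using h) (fun _ => S.τ₀) ‖S.τ₀‖ (fun _ => le_rfl)
  obtain ⟨t₃, h₃⟩ := exists_weightedComposition (K := Unit)
    (fun p : ℤ × ℤ => ((p.1 - 1, p.2, Dir.right) : Edge)) (fun _ => ())
    (by rintro ⟨m, n⟩ ⟨m', n'⟩ h; simpa using h)
    (fun p => Complex.exp (-(Complex.I * Real.pi * p.2 * θ)) • S.τ₁) ‖S.τ₁‖
    (fun p => by simp [norm_smul, Complex.norm_exp])
  obtain ⟨t₄, h₄⟩ := exists_weightedComposition (K := Unit)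
    (fun p : ℤ × ℤ => ((p.1, p.2 - 1, Dir.up) : Edge)) (fun _ => ())
    (by rintro ⟨m, n⟩ ⟨m', n'⟩ h; simpa using h)
    (fun p => Complex.exp (Complex.I * Real.pi * p.1 * θ) • S.τ₁) ‖S.τ₁‖
    (fun p => by simp [norm_smul, Complex.norm_exp])
  refine ⟨t₁ + (β : ℂ) • t₂ - t₃ - (β : ℂ) • t₄, fun h m n => ?_⟩
  have e : (t₁ + (β : ℂ) • t₂ - t₃ - (β : ℂ) • t₄) h (m, n)
    = t₁ h (m, n) + β * t₂ h (m, n) - t₃ h (m, n) - β * t₄ h (m, n) := rfl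
  rw [e, h₁, h₂, h₃, h₄]
  rfl

/-- The flux condition of the solution with right-hand side `h` and node values `g`. -/
theorem EdgeResolvent.flux_eq (S : EdgeResolvent l V z) {α β θ : ℝ} {h : Edge → EdgeSpace l}
    {φ : Edge → ℝ → ℂ} (hφ : ∀ e, IsEdgeSolution l V z (h e) (φ e)) {g : ℤ × ℤ → ℂ}
    (h0 : ∀ e : Edge, φ e 0 = edgeWeight β e * g (e.1, e.2.1))
    (h1 : ∀ e : Edge, φ e l = edgeWeight β e * edgeHop θ e * g (endNode e)) (m n : ℤ) :
    edgeDeriv l (φ (m, n, Dir.right)) 0 + β * edgeDeriv l (φ (m, n, Dir.up)) 0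
      - Complex.exp (-(Complex.I * Real.pi * n * θ)) * edgeDeriv l (φ (m - 1, n, Dir.right)) l
      - β * (Complex.exp (Complex.I * Real.pi * m * θ) * edgeDeriv l (φ (m, n - 1, Dir.up)) l)
      - α * g (m, n)
    = ((1 + (β : ℂ) ^ 2) * (kreinMatrix l V z 0 0 + kreinMatrix l V z 1 1) - (α : ℂ)) * g (m, n)
        + kreinMatrix l V z 0 1 * (Complex.exp (Complex.I * Real.pi * n * θ) * g (m + 1, n)
        + Complex.exp (-(Complex.I * Real.pi * n * θ)) * g (m - 1, n)
        + β ^ 2 * (Complex.exp (-(Complex.I * Real.pi * m * θ)) * g (m, n + 1)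
          + Complex.exp (Complex.I * Real.pi * m * θ) * g (m, n - 1)))
      + (S.τ₀ (h (m, n, Dir.right)) + β * S.τ₀ (h (m, n, Dir.up))
        - Complex.exp (-(Complex.I * Real.pi * n * θ)) * S.τ₁ (h (m - 1, n, Dir.right))
        - β * (Complex.exp (Complex.I * Real.pi * m * θ) * S.τ₁ (h (m, n - 1, Dir.up)))) := by
  have er : ∀ n : ℤ, Complex.exp (Complex.I * Real.pi * n * θ)
      * Complex.exp (-(Complex.I * Real.pi * n * θ)) = 1 := fun n => by
    rw [← Complex.exp_add, add_neg_cancel, Complex.exp_zero]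
  rw [S.deriv_zero _ _ (hφ _), S.deriv_zero _ _ (hφ _), S.deriv_end _ _ (hφ _),
    S.deriv_end _ _ (hφ _)]
  simp only [h0, h1, edgeWeight, edgeHop, endNode, sub_add_cancel]
  -- On an incoming edge the phase in the end value is inverse to the phase in the flux, so the
  -- `s₂₂` terms carry no phase. On vertical edges `β` enters through both value and flux, whence
  -- `β²`.
  linear_combination (kreinMatrix l V z 1 1 * g (m, n)) * er n
    + (β ^ 2 * kreinMatrix l V z 1 1 * g (m, n)) * er m

/-- The lattice problem after the gauge transformation. -/
theorem EdgeResolvent.gauged_problem_iff (S : EdgeResolvent l V z) {α β θ : ℝ}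
    {R : LatticeSpace l →L[ℂ] LatticeSpace l} (hR : ∀ h e, R h e = S.R (h e))
    {γ : L2Z2 →L[ℂ] LatticeSpace l}
    (hγ : ∀ g e, γ g e = (edgeWeight β e * g (e.1, e.2.1)) • S.v
      + (edgeWeight β e * edgeHop θ e * g (endNode e)) • S.w)
    {τ : LatticeSpace l →L[ℂ] L2Z2} (hτ : ∀ h m n, τ h (m, n)
      = S.τ₀ (h (m, n, Dir.right)) + β * S.τ₀ (h (m, n, Dir.up))
        - Complex.exp (-(Complex.I * Real.pi * n * θ)) * S.τ₁ (h (m - 1, n, Dir.right))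
        - β * (Complex.exp (Complex.I * Real.pi * m * θ) * S.τ₁ (h (m, n - 1, Dir.up))))
    (f h : LatticeSpace l) :
    (∃ φ : Edge → ℝ → ℂ, (∀ e, IsEdgeSolution l V z (h e) (φ e)) ∧
      (∀ e, f e =ᵐ[edgeMeasure l] φ e) ∧
      GaugedConditions θ α β φ l fun p => φ (p.1, p.2, Dir.right) 0) ↔
    ∃ g : L2Z2, f = R h + γ g ∧ vertexOperator l V α β θ z g + τ h = 0 := by
  have hsum : ∀ (g : L2Z2) (e : Edge), (R h + γ g) e
      = S.R (h e) + (edgeWeight β e * g (e.1, e.2.1)) • S.v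
        + (edgeWeight β e * edgeHop θ e * g (endNode e)) • S.w := fun g e => by
    have h1 : (R h + γ g) e = R h e + γ g e := rfl
    rw [h1, hR, hγ, add_assoc]
  have hN : ∀ (g : L2Z2) (m n : ℤ), (vertexOperator l V α β θ z g + τ h) (m, n)
      = vertexOperator l V α β θ z g (m, n) + τ h (m, n) := fun g m n => rfl
  constructor
  · rintro ⟨φ, hφ, hf, hc⟩
    have hfe : ∀ e, f e = S.R (h e) + φ e 0 • S.v + φ e l • S.w := fun e =>
      Lp.ext ((hf e).trans (S.ae_eq _ _ (hφ e)).symm)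
    -- The node values must be shown to form an `ℓ²` sequence. On a right edge `f - R h = φ(0) v +
    -- φ(l) w`, and `κ v = 1`, `κ w = 0`, so `κ` applied edgewise is a bounded operator that
    -- recovers them.
    obtain ⟨κ, hκ⟩ := exists_weightedComposition (K := Unit)
      (fun p : ℤ × ℤ => ((p.1, p.2, Dir.right) : Edge)) (fun _ => ())
      (by rintro ⟨m, n⟩ ⟨m', n'⟩ h; simpa using h) (fun _ => S.κ) ‖S.κ‖ (fun _ => le_rfl)
    have hg : ∀ p : ℤ × ℤ, κ (f - R h) p = φ (p.1, p.2, Dir.right) 0 := fun p => by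
      have h1 : (f - R h) (p.1, p.2, Dir.right) = f (p.1, p.2, Dir.right)
        - R h (p.1, p.2, Dir.right) := rfl
      rw [hκ, h1, hfe, hR, add_assoc, add_sub_cancel_left, map_add, map_smul, map_smul, S.κ_v,
        S.κ_w, smul_zero, add_zero, smul_eq_mul, mul_one]
    refine ⟨κ (f - R h), lp.ext (funext fun e => ?_), lp.ext (funext fun ⟨m, n⟩ => ?_)⟩
    · rw [hsum, hfe, hg, hg, hc.start, hc.finish]
    · rw [hN, vertexOperator_apply, hτ]
      simp only [hg]
      have h1 := S.flux_eq (α := α) (g := fun p => φ (p.1, p.2, Dir.right) 0) hφ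
        hc.start hc.finish m n
      refine h1.symm.trans ?_
      rw [hc.flux m n, sub_self]
      rfl
  · rintro ⟨g, rfl, hg⟩
    choose φ hφ h0 h1 using fun e => S.exists_solution (h e) (edgeWeight β e * g (e.1, e.2.1))
      (edgeWeight β e * edgeHop θ e * g (endNode e))
    have hg0 : (fun p : ℤ × ℤ => φ (p.1, p.2, Dir.right) 0) = g := by
      funext p
      rw [h0, edgeWeight, one_mul]
    refine ⟨φ, hφ, fun e => ?_, ?_⟩
    · rw [hsum, ← h0, ← h1]
      exact S.ae_eq _ _ (hφ e)
    · rw [hg0]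
      refine ⟨h0, h1, fun m n => ?_⟩
      rw [← sub_eq_zero, S.flux_eq hφ h0 h1 m n, ← vertexOperator_apply, ← hτ, ← hN, hg]
      rfl

/-! ### The Hamiltonian through the gauge transformation -/

/-- The gauge transformation as an operator on the Hilbert space of the lattice, with its
inverse. -/
theorem exists_gauge (F : PeriodicMagneticField l) :
    ∃ U U' : LatticeSpace l →L[ℂ] LatticeSpace l,
      (∀ f, U (U' f) = f) ∧ (∀ f, U' (U f) = f) ∧
      ∀ f e, U f e =ᵐ[edgeMeasure l] phaseMul (F.edgePhase e) (f e) := by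
  choose W hW1 hW using fun e : Edge => exists_phaseCLM l (F.continuous_edgePhase e)
  choose W' hW1' hW' using fun e : Edge => exists_phaseCLM l (F.continuous_edgePhase e).neg
  have hinj : Function.Injective fun e : Edge => (e, ()) := fun a b h => by simpa using h
  obtain ⟨U, hU⟩ := exists_weightedComposition id (fun _ => ()) hinj W 1 hW1
  obtain ⟨U', hU'⟩ := exists_weightedComposition id (fun _ => ()) hinj W' 1 hW1'
  have h1 : ∀ f e, U f e =ᵐ[edgeMeasure l] phaseMul (F.edgePhase e) (f e) := fun f e => by
    rw [hU]
    exact hW e _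
  have h2 : ∀ f e, U' f e =ᵐ[edgeMeasure l] phaseMul (-F.edgePhase e) (f e) := fun f e => by
    rw [hU']
    exact hW' e _
  refine ⟨U, U', fun f => lp.ext (funext fun e => Lp.ext ?_),
    fun f => lp.ext (funext fun e => Lp.ext ?_), h1⟩
  · filter_upwards [h1 (U' f) e, h2 f e] with t a1 a2
    rw [a1, phaseMul, a2]
    exact congrFun (phaseMul_neg (F.edgePhase e) (f e)) t
  · filter_upwards [h2 (U f) e, h1 f e] with t a1 a2
    rw [a1, phaseMul, a2]
    have h3 := congrFun (phaseMul_neg (-F.edgePhase e) (f e)) t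
    rwa [neg_neg] at h3

/-- Conjugation by the unimodular phase removes the potential from the edge equations and turns the
vertex conditions into the gauged ones. -/
theorem mem_hamiltonian_graph_iff (hl : 0 < l) (F : PeriodicMagneticField l) {α β : ℝ}
    (hβ : β ≠ 0) {U U' : LatticeSpace l →L[ℂ] LatticeSpace l} (hU : ∀ f, U (U' f) = f)
    (hphase : ∀ f e, U f e =ᵐ[edgeMeasure l] phaseMul (F.edgePhase e) (f e))
    (f h : LatticeSpace l) :
    (f, h + z • f) ∈ (hamiltonian hl F V α β).graph ↔
      ∃ φ : Edge → ℝ → ℂ, (∀ e, IsEdgeSolution l V z (U' h e) (φ e)) ∧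
      (∀ e, U' f e =ᵐ[edgeMeasure l] φ e) ∧
      GaugedConditions F.theta α β φ l fun p => φ (p.1, p.2, Dir.right) 0 := by
  have hph : ∀ f e, f e =ᵐ[edgeMeasure l] phaseMul (F.edgePhase e) (U' f e) := fun f e => by
    have h1 := hphase (U' f) e
    rwa [hU] at h1
  rw [hamiltonian_graph]
  constructor
  · rintro ⟨u, hu, hc, hf, hg⟩
    -- Removing the phase is multiplication by the phase of the potential `-A`, so the regularity
    -- lemma applies with the sign reversed.
    have hφ : ∀ e, MemH2 l (phaseMul (-F.edgePhase e) (u e)) := fun e =>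
      (hu e).phaseMul (A := -F.edgePotential e) hl (fun t => (F.hasDerivAt_edgePhase e t).neg)
        (by
          obtain ⟨w, hw, hw'⟩ := F.memH1_edgePotential e
          refine ⟨-w, hw.neg, fun t ht => ?_⟩
          simp only [Pi.neg_apply, hw' t ht, intervalIntegral.integral_neg]
          ring)
    have hu' : u = fun e => phaseMul (F.edgePhase e) (phaseMul (-F.edgePhase e) (u e)) :=
      funext fun e => (phaseMul_neg _ _).symm
    have hpair := fun e => (magnetic_pair_iff (V := V) (z := z) hl (F.hasDerivAt_edgePhase e) (hφ e)
      (U' f e) (U' h e) (hph f e) (hph h e)).1 (by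
        rw [phaseMul_neg]
        exact ⟨hf e, hg e⟩)
    rw [hu', vertexConditions_phaseMul_iff hl F hβ hφ] at hc
    exact ⟨_, fun e => (hpair e).2, fun e => (hpair e).1, hc⟩
  · rintro ⟨φ, hφ, hf, hc⟩
    have hpair := fun e => (magnetic_pair_iff (V := V) (z := z) hl (F.hasDerivAt_edgePhase e)
      (hφ e).1 (U' f e) (U' h e) (hph f e) (hph h e)).2 ⟨hf e, hφ e⟩
    exact ⟨fun e => phaseMul (F.edgePhase e) (φ e), fun e => (hφ e).1.phaseMul hl
      (F.hasDerivAt_edgePhase e) (F.memH1_edgePotential e),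
      (vertexConditions_phaseMul_iff hl F hβ fun e => (hφ e).1).2 hc, fun e => (hpair e).1,
      fun e => (hpair e).2⟩

/-- The resolvent set of the lattice Hamiltonian outside the Dirichlet spectrum. -/
theorem mem_resolventSet_hamiltonian_iff (hl : 0 < l) (F : PeriodicMagneticField l)
    (hV : MemLp V 2 (edgeMeasure l)) (α : ℝ) {β : ℝ} (hβ : β ≠ 0)
    (hz : z ∉ unboundedSpectrum (dirichletOperator l V)) :
    z ∈ resolventSet (hamiltonian hl F V α β) ↔ IsUnit (vertexOperator l V α β F.theta z) := by
  obtain ⟨S⟩ := exists_edgeResolvent hl hV hz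
  obtain ⟨U, U', hUU', hU'U, hphase⟩ := exists_gauge F
  obtain ⟨γ, hγ⟩ := S.exists_nodeExtension F.theta β
  obtain ⟨τ, hτ⟩ := S.exists_nodeFlux F.theta β
  obtain ⟨R, hR⟩ := exists_weightedComposition (id : Edge → Edge) (fun _ => ())
    (fun a b h => by simpa using h) (fun _ => S.R) ‖S.R‖ (fun _ => le_rfl)
  refine mem_resolventSet_iff_isUnit (U ∘L R ∘L U') (U ∘L γ) (τ ∘L U') _ ?_ ?_ fun f h => ?_
  · have h1 : Function.Injective γ := by
      rw [injective_iff_map_eq_zero]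
      intro g hg
      refine lp.ext (funext fun p => ?_)
      have h2 := hγ g (p.1, p.2, Dir.right)
      rw [hg] at h2
      have h3 := congrArg S.κ h2
      simp only [map_add, map_smul, S.κ_v, S.κ_w, mul_zero, add_zero, edgeWeight, one_mul,
        smul_eq_mul, mul_one] at h3
      exact h3.symm.trans (map_zero S.κ)
    exact (Function.LeftInverse.injective hU'U).comp h1
  · have h1 : Function.Surjective τ := fun y => by
      -- A right inverse of `τ`: put `y (m, n) χ` on the right edge leaving `(m, n)` and zero on
      -- vertical edges. Since `τ₀ χ = 1` and `τ₁ χ = 0`, it creates flux `y (m, n)` at its start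
      -- and none at its end.
      obtain ⟨X, hX⟩ := exists_weightedComposition (fun e : Edge => (e.1, e.2.1)) dirIndex
        injective_startNode (fun e : Edge => match e with
          | (_, _, Dir.right) => ContinuousLinearMap.toSpanSingleton ℂ S.χ
          | (_, _, Dir.up) => 0) ‖S.χ‖ (by
        rintro ⟨m, n, _ | _⟩ <;> simp [ContinuousLinearMap.norm_toSpanSingleton])
      refine ⟨X y, lp.ext (funext fun ⟨m, n⟩ => ?_)⟩
      rw [hτ]
      simp [hX, S.τ₀_χ, S.τ₁_χ]
    exact h1.comp (Function.RightInverse.surjective hU'U)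
  · rw [mem_hamiltonian_graph_iff hl F hβ hUU' hphase, S.gauged_problem_iff hR hγ hτ]
    refine exists_congr fun g => and_congr_left fun _ => ⟨fun h1 => ?_, fun h1 => ?_⟩
    · rw [← hUU' f, h1, map_add]
      rfl
    · have h2 : f = U (R (U' h) + γ g) := by rw [h1, map_add]; rfl
      rw [h2, hU'U]

end

end QuantumGraph

end

theorem mainTheorem7 (l : ℝ) (hl : 0 < l) (F : QuantumGraph.PeriodicMagneticField l)
    (V : ℝ → ℝ) (hV : MemLp V 2 (QuantumGraph.edgeMeasure l)) (α β : ℝ) (hβ : β ≠ 0) (z : ℝ)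
    (hz : (z : ℂ) ∉ QuantumGraph.unboundedSpectrum (QuantumGraph.dirichletOperator l V)) :
    (z : ℂ) ∈ QuantumGraph.unboundedSpectrum (QuantumGraph.hamiltonian hl F V α β) ↔
      (0 : ℂ) ∈ spectrum ℂ
        (((1 + (β : ℂ) ^ 2) * (QuantumGraph.kreinMatrix l V z 0 0 + QuantumGraph.kreinMatrix l V z 1 1)
            - (α : ℂ)) • (1 : QuantumGraph.L2Z2 →L[ℂ] QuantumGraph.L2Z2)
          + QuantumGraph.kreinMatrix l V z 0 1 •
            QuantumGraph.discreteMagneticLaplacian F.theta β) := by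
  rw [spectrum.zero_mem_iff, QuantumGraph.unboundedSpectrum, mem_compl_iff]
  exact not_congr (QuantumGraph.mem_resolventSet_hamiltonian_iff hl F hV α hβ hz)
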